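/- Let $d\in\mathbb N$, and fix the parameters $g>0$ and $a\in\mathbb R$. Let $\rho_{g,a}$ be the probability measure on $\mathbb R$ with density proportional to $e^{-gt^4-at^2}$, and let $|\rho_{g,a}|$ be its image on $\mathbb R^+=[0,\infty)$ under $t\mapsto|t|$. For a finite set $\Lambda\subset\mathbb Z^d$ let $E(\Lambda)$ be the set of nearest-neighbour edges $xy$ of $\mathbb Z^d$ with $x,y\in\Lambda$. For $\beta\ge 0$, the free $\varphi^4$ random cluster measure $\Psi^0_{\Lambda,\beta}$ is the probability measure on pairs $(\omega,\mathsf a)\in\{0,1\}^{E(\Lambda)}\times(\mathbb R^+)^\Lambda$ given by $$\mathrm d\Psi^0_{\Lambda,\beta}[(\omega,\mathsf a)]=\frac1{Z^0_{\Lambda,\beta}}\prod_{xy\in E(\Lambda)}\sqrt{1-p(\beta,\mathsf a)_{xy}}\left(\frac{p(\beta,\mathsf a)_{xy}}{1-p(\beta,\mathsf a)_{xy}}\right)^{\omega_{xy}}2^{k(\omega)}\prod_{x\in\Lambda}\mathrm d|\rho_{g,a}|(\mathsf a_x),\qquad p(\beta,\mathsf a)_{xy}=1-e^{-2\beta\mathsf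 a_x\mathsf a_y},$$ where $k(\omega)$ is the number of connected components of the graph $(\Lambda,\{e\in E(\Lambda):\omega_e=1\})$ (isolated vertices included) and $Z^0_{\Lambda,\beta}$ is the normalisation constant. Let $\Phi^0_{\Lambda,\beta}$ be the marginal of $\Psi^0_{\Lambda,\beta}$ on $\omega$. For $\varepsilon\in[0,1]$ let $\Gamma^0_{\Lambda,\beta,\varepsilon}$ be the law of $\omega\cup\gamma$, where $(\omega\cup\gamma)_e=\max\{\omega_e,\gamma_e\}$, $\omega$ has law $\Phi^0_{\Lambda,\beta}$, and $\gamma\in\{0,1\}^{E(\Lambda)}$ is independent of $\omega$ with i.i.d. Bernoulli($\varepsilon$) coordinates. Then for all $0<\beta'<\beta$ there exists $\varepsilon\in(0,1]$, depending only on $\beta'$, $\beta$ and the fixed parameters $d,g,a$, such that for every finite $\Lambda\subset\mathbb Z^d$ the measure $\Phi^0_{\Lambda,\beta}$ stochastically dominates $\Gamma^0_{\Lambda,\beta',\varepsilon}$, that is, $$\int F\,\mathrm d\Gamma^0_{\Lambda,\beta',\varepsilon}\le\int F\,\mathrm d\Phi^0_{\Lambda,\beta}$$ for every function $F:\{0,1\}^{E(\Lambda)}\to\mathbb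 R$ that is increasing for the coordinatewise order. -/

import Mathlib

open MeasureTheory
open scoped NNReal ENNReal unitInterval

noncomputable section

namespace Phi4

/-! ### Single-site measure -/

/-- The unnormalised density `exp (-g t^4 - a t^2)`. -/
def siteDensity (g a t : ℝ) : ℝ≥0∞ :=
  ENNReal.ofReal (Real.exp (-g * t ^ 4 - a * t ^ 2))

/-- The single-site measure `ρ_{g,a}` on `ℝ`, with density `exp (-g t^4 - a t^2) / z_{g,a}`. -/
def siteMeasure (g a : ℝ) : Measure ℝ :=
  (∫⁻ t, siteDensity g a t)⁻¹ • (volume : Measure ℝ).withDensity (siteDensity g a)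

/-- The law of the absolute value `|t|` when `t` has law `ρ_{g,a}`. -/
def absSiteMeasure (g a : ℝ) : Measure ℝ≥0 :=
  (siteMeasure g a).map Real.nnabs

/-! ### Percolation configurations on a finite graph -/

section Graph

variable {V : Type} [Fintype V] [DecidableEq V] (G : SimpleGraph V) [DecidableRel G.Adj]

/-- Configurations `ω ∈ {0,1}^E`: an edge `e` is open when `ω e = true`. The order is the
pointwise one, with `false < true`. -/
abbrev Config : Type := G.edgeSet → Bool

variable {G}

/-- The subgraph of open edges, on the full vertex set. -/
def openGraph (ω : Config G) : SimpleGraph V :=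
  SimpleGraph.fromEdgeSet {e | ∃ h : e ∈ G.edgeSet, ω ⟨e, h⟩ = true}

/-- The number of connected components of `(V, {e : ω e = 1})`, isolated vertices included. -/
def numClusters (ω : Config G) : ℕ :=
  Nat.card (openGraph ω).ConnectedComponent

/-- `p(β, s)_{xy} = 1 - exp (-2 β s_x s_y)`. -/
def edgeProb (β : ℝ) (s : V → ℝ≥0) (e : Sym2 V) : ℝ :=
  1 - Real.exp (-2 * β * ((e.map s).mul : ℝ≥0))

/-- The weight `∏_{xy} √(1 - p_{xy}) (p_{xy} / (1 - p_{xy}))^{ω_{xy}} 2^{k(ω)}`. -/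
def rcWeight (β : ℝ) (ω : Config G) (s : V → ℝ≥0) : ℝ :=
  (∏ e : G.edgeSet, Real.sqrt (1 - edgeProb β s e) *
    (edgeProb β s e / (1 - edgeProb β s e)) ^ (if ω e = true then 1 else 0)) *
    2 ^ numClusters ω

variable (G)

/-- The unnormalised free `φ⁴` random cluster measure on pairs `(ω, s)`: the weight above
times (counting measure in `ω`) ⊗ (product over the vertices of the law of `|φ_x|`).
Edges leaving the graph carry the boundary value `0` of the field, so that `p = 0` on them: they
are closed, and only contribute a constant factor that the normalisation removes. -/
def freeRCUnnormalized (g a β : ℝ) : Measure (Config G × (V → ℝ≥0)) :=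
  (Measure.count.prod (Measure.pi fun _ : V => absSiteMeasure g a)).withDensity
    fun x => ENNReal.ofReal (rcWeight β x.1 x.2)

/-- The free `φ⁴` random cluster measure `Ψ⁰_β`. -/
def freeRC (g a β : ℝ) : Measure (Config G × (V → ℝ≥0)) :=
  (freeRCUnnormalized G g a β Set.univ)⁻¹ • freeRCUnnormalized G g a β

/-- The edge marginal `Φ⁰_β` of `Ψ⁰_β`. -/
def freeRCEdge (g a β : ℝ) : Measure (Config G) :=
  (freeRC G g a β).map Prod.fst

/-- Bernoulli bond percolation: every edge is open with probability `ε`, independently. -/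
def bernoulliPerc (ε : I) : Measure (Config G) :=
  Measure.pi fun _ : G.edgeSet => ProbabilityTheory.bernoulliMeasure true false ε

/-- The union of two configurations: an edge is open iff it is open in at least one of them. -/
def unionConfig (x : Config G × Config G) : Config G :=
  fun e => x.1 e || x.2 e

/-- The law `Γ⁰_{β,ε}` of `ω ∪ γ`, with `ω` of law `Φ⁰_β` and `γ` an independent Bernoulli
bond percolation of parameter `ε`. -/
def sprinkledRCEdge (g a β : ℝ) (ε : I) : Measure (Config G) :=
  ((freeRCEdge G g a β).prod (bernoulliPerc G ε)).map (unionConfig G)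

end Graph

/-- `μ` stochastically dominates `ν`: every bounded measurable increasing function has a larger
expectation under `μ` than under `ν`. -/
def StochDominates {Ω : Type} [MeasurableSpace Ω] [Preorder Ω] (μ ν : Measure Ω) : Prop :=
  ∀ F : Ω → ℝ, Monotone F → Measurable F → (∃ C : ℝ, ∀ ω, |F ω| ≤ C) →
    ∫ ω, F ω ∂ν ≤ ∫ ω, F ω ∂μ

/-! ### The lattice -/

/-- The nearest-neighbour graph on `ℤ^d`: `x ∼ y` iff `‖x - y‖₁ = 1`. -/
def latticeGraph (d : ℕ) : SimpleGraph (Fin d → ℤ) where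
  Adj x y := ∑ i, |x i - y i| = 1
  symm := ⟨fun x y h => by simpa only [abs_sub_comm] using h⟩
  loopless := ⟨fun x h => by simp at h⟩

instance (d : ℕ) : DecidableRel (latticeGraph d).Adj := fun x y =>
  inferInstanceAs (Decidable (∑ i, |x i - y i| = 1))

/-- The graph `(Λ, E(Λ))`, whose edges are those of `ℤ^d` with both endpoints in `Λ`. -/
abbrev boxGraph {d : ℕ} (Λ : Finset (Fin d → ℤ)) : SimpleGraph Λ :=
  (latticeGraph d).comap Subtype.val

end Phi4

end

/-! Given the field `s`, the edges form a random cluster model with cluster weight 2 and couplings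
`β s_x s_y`; the field itself has density proportional to the partition function of that model. The
couplings are lowered from `β` to `β'` one edge at a time (`rcExp_sprinkle_univ_le`), so the claim
reduces to `rcExp_sprinkle_le`: raising the coupling of a single edge `e = xy` by `c = β - β'`
dominates opening `e` independently with probability `ε`, where `ε` depends neither on the graph nor
on the other couplings.

Three facts give the single-edge step. With the field frozen, raising the coupling dominates opening
`e` with probability `tanh (c s_x s_y)` (`fk_sprinkle`, from positive correlation). The field
becomes stochastically larger when couplings grow, because partition functions satisfy a lattice
condition in the field (`fkZ_coupling_four`, `lintegral_four_functions`), and frozen-field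
expectations of increasing functions increase with the field (`fk_coupling_mono`). Finally, the
random probability `tanh (c s_x s_y)` is averaged over the field conditionally on the edge
configuration, and this average is at least `ε` whatever the configuration
(`exists_le_integral_tanh`).

The last fact is where uniformity comes from. Given the edges, the field at a vertex has the quartic
density times explicit factors of its neighbours. Integration by parts against two test functions
bounds its fourth moment, after a maximum principle over vertices, and the probability that it is
small. -/

noncomputable section

namespace Phi4

set_option linter.unusedSectionVars false

/-! ### Random cluster model with arbitrary couplings: lattice inequalities and the effect of
changing one coupling. -/

section FiniteFK

variable {V : Type} [Fintype V] [DecidableEq V] {G : SimpleGraph V} [DecidableRel G.Adj]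

/-- Functions that are constant along the open edges. -/
def openConst (ω : Config G) : Submodule ℝ (V → ℝ) where
  carrier := {f | ∀ x y, (h : s(x, y) ∈ G.edgeSet) → ω ⟨s(x, y), h⟩ = true → f x = f y}
  add_mem' := fun {f f'} hf hf' x y h ho => by
    simp only [Pi.add_apply, hf x y h ho, hf' x y h ho]
  zero_mem' := fun _ _ _ _ => rfl
  smul_mem' := fun c f hf x y h ho => by simp only [Pi.smul_apply, hf x y h ho]

lemma mem_openConst {ω : Config G} {f : V → ℝ} : f ∈ openConst ω ↔
    ∀ x y, (h : s(x, y) ∈ G.edgeSet) → ω ⟨s(x, y), h⟩ = true → f x = f y := Iff.rfl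

lemma openGraph_adj {ω : Config G} {x y : V} :
    (openGraph ω).Adj x y ↔ ∃ h : s(x, y) ∈ G.edgeSet, ω ⟨s(x, y), h⟩ = true := by
  rw [openGraph, SimpleGraph.fromEdgeSet_adj, Set.mem_ofPred_eq]
  refine ⟨fun h => h.1, fun h => ⟨h, ?_⟩⟩
  obtain ⟨h, -⟩ := h
  exact ((SimpleGraph.mem_edgeSet G).1 h).ne

/-- Functions constant along open edges form the kernel of the Laplacian of the open graph. Cluster
counts become dimensions, so their inequalities follow from linear algebra. -/
lemma numClusters_eq_finrank (ω : Config G) :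
    numClusters ω = Module.finrank ℝ (openConst ω) := by
  classical
  have h := SimpleGraph.card_connectedComponent_eq_finrank_ker_toLin'_lapMatrix (openGraph ω)
  rw [numClusters, Nat.card_eq_fintype_card, h]
  have hk : LinearMap.ker (Matrix.toLin' ((openGraph ω).lapMatrix ℝ)) = openConst ω := by
    ext f
    rw [LinearMap.mem_ker, Matrix.toLin'_apply,
      SimpleGraph.lapMatrix_mulVec_eq_zero_iff_forall_adj]
    simp only [openGraph_adj, mem_openConst, forall_exists_index]
  rw [hk]

lemma openConst_anti {ω η : Config G} (h : ω ≤ η) : openConst η ≤ openConst ω := by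
  intro f hf x y hxy ho
  refine hf x y hxy ?_
  have := h ⟨s(x, y), hxy⟩
  rw [ho] at this
  exact top_le_iff.1 this

lemma openConst_sup (ω η : Config G) : openConst (ω ⊔ η) = openConst ω ⊓ openConst η := by
  apply le_antisymm (le_inf (openConst_anti le_sup_left) (openConst_anti le_sup_right))
  rintro f ⟨h₁, h₂⟩ x y hxy ho
  simp only [Pi.sup_apply, Bool.sup_eq_bor, Bool.or_eq_true] at ho
  exact ho.elim (h₁ x y hxy) (h₂ x y hxy)

lemma numClusters_anti {ω η : Config G} (h : ω ≤ η) : numClusters η ≤ numClusters ω := by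
  simp only [numClusters_eq_finrank]
  exact Submodule.finrank_mono (openConst_anti h)

/-- Dimension formula for the sum and intersection of two subspaces: the intersection is exactly the
space of `ω ⊔ η`, while the sum is only contained in that of `ω ⊓ η`. -/
lemma numClusters_supermodular (ω η : Config G) :
    numClusters ω + numClusters η ≤ numClusters (ω ⊔ η) + numClusters (ω ⊓ η) := by
  simp only [numClusters_eq_finrank]
  rw [openConst_sup, ← Submodule.finrank_sup_add_finrank_inf_eq, add_comm]
  exact Nat.add_le_add_left (Submodule.finrank_mono
    (sup_le (openConst_anti inf_le_left) (openConst_anti inf_le_right))) _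

lemma le_update_true (ω : Config G) (e : G.edgeSet) : ω ≤ Function.update ω e true := by
  exact le_update_iff.2 ⟨le_top, fun _ _ => le_rfl⟩

lemma update_true_mono {ω η : Config G} (h : ω ≤ η) (e : G.edgeSet) :
    Function.update ω e true ≤ Function.update η e true :=
  update_le_update_iff.2 ⟨le_rfl, fun i _ => h i⟩

/-- Opening `e = xy` adds the single linear constraint `f x = f y`, which lowers the dimension by at
most one. -/
lemma numClusters_le_update_add_one (ω : Config G) (e : G.edgeSet) :
    numClusters ω ≤ numClusters (Function.update ω e true) + 1 := by
  simp only [numClusters_eq_finrank]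
  obtain ⟨e, he⟩ := e
  induction e using Sym2.ind with
  | _ x y =>
  let φ : (V → ℝ) →ₗ[ℝ] ℝ := LinearMap.proj (R := ℝ) (φ := fun _ => ℝ) x - LinearMap.proj y
  have hsub : openConst ω ⊓ LinearMap.ker φ ≤
      openConst (Function.update ω ⟨s(x, y), he⟩ true) := by
    rintro f ⟨h₁, h₂⟩ u v huv ho
    have h₂ : f x = f y := by simpa [φ, sub_eq_zero] using h₂
    by_cases hc : s(u, v) = s(x, y)
    · rcases Sym2.eq_iff.1 hc with ⟨rfl, rfl⟩ | ⟨rfl, rfl⟩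
      · exact h₂
      · exact h₂.symm
    · rw [Function.update_of_ne (fun h => hc (congrArg Subtype.val h))] at ho
      exact h₁ u v huv ho
  have h1 := Submodule.finrank_sup_add_finrank_inf_eq (openConst ω) (LinearMap.ker φ)
  have h2 := φ.finrank_range_add_finrank_ker
  have h3 : Module.finrank ℝ (LinearMap.range φ) ≤ 1 := by
    simpa using Submodule.finrank_le (LinearMap.range φ)
  have h4 := Submodule.finrank_le (openConst ω ⊔ LinearMap.ker φ)
  have h5 := Submodule.finrank_mono hsub
  omega

/-- The weight of a single edge with coupling `J`. -/
def edgeFactor (J : ℝ) (o : Bool) : ℝ := if o then 2 * Real.sinh J else Real.exp (-J)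

/-- The random cluster weight (with cluster weight `2`) with couplings `J`. -/
def fkWeight (J : G.edgeSet → ℝ) (ω : Config G) : ℝ :=
  (∏ e, edgeFactor (J e) (ω e)) * 2 ^ numClusters ω

/-- The partition function of the random cluster model. -/
def fkZ (J : G.edgeSet → ℝ) : ℝ := ∑ ω : Config G, fkWeight J ω

lemma edgeFactor_nonneg {J : ℝ} (hJ : 0 ≤ J) (o : Bool) : 0 ≤ edgeFactor J o := by
  have := Real.sinh_nonneg_iff.2 hJ
  unfold edgeFactor
  split_ifs <;> positivity

lemma fkWeight_nonneg {J : G.edgeSet → ℝ} (hJ : 0 ≤ J) (ω : Config G) : 0 ≤ fkWeight J ω :=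
  mul_nonneg (Finset.prod_nonneg fun e _ => edgeFactor_nonneg (hJ e) _) (by positivity)

lemma fkWeight_bot_pos (J : G.edgeSet → ℝ) : 0 < fkWeight J ⊥ := by
  unfold fkWeight
  refine mul_pos (Finset.prod_pos fun e _ => ?_) (by positivity)
  simp [edgeFactor, Real.exp_pos]

lemma fkZ_pos {J : G.edgeSet → ℝ} (hJ : 0 ≤ J) : 0 < fkZ J :=
  Finset.sum_pos' (fun ω _ => fkWeight_nonneg hJ ω) ⟨⊥, Finset.mem_univ _, fkWeight_bot_pos J⟩

lemma sinh_mul_exp_neg_le {J J' : ℝ} (h : J ≤ J') :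
    Real.sinh J * Real.exp (-J') ≤ Real.exp (-J) * Real.sinh J' := by
  simp only [Real.sinh_eq, sub_div, sub_mul, mul_sub, ← Real.exp_add, div_mul_eq_mul_div,
    mul_div_assoc', add_comm (-J) J']
  have : Real.exp (J + -J') ≤ Real.exp (J' + -J) := Real.exp_le_exp.2 (by linarith)
  linarith

/-- Only `o = true`, `o' = false` is not an equality; there the inequality says that the odds of
being open increase with the coupling. -/
lemma edgeFactor_holley {J J' : ℝ} (h : J ≤ J') (o o' : Bool) :
    edgeFactor J o * edgeFactor J' o' ≤ edgeFactor J (o ⊓ o') * edgeFactor J' (o ⊔ o') := by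
  have := sinh_mul_exp_neg_le h
  cases o <;> cases o' <;> simp [edgeFactor]
  linarith

lemma fkWeight_holley {J J' : G.edgeSet → ℝ} (h0 : 0 ≤ J) (h : J ≤ J') (ω η : Config G) :
    fkWeight J ω * fkWeight J' η ≤ fkWeight J (ω ⊓ η) * fkWeight J' (ω ⊔ η) := by
  have h0' : 0 ≤ J' := h0.trans h
  unfold fkWeight
  rw [mul_mul_mul_comm, mul_mul_mul_comm (∏ e, edgeFactor (J e) ((ω ⊓ η) e)),
    ← Finset.prod_mul_distrib, ← Finset.prod_mul_distrib, ← pow_add, ← pow_add]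
  refine mul_le_mul (Finset.prod_le_prod (fun e _ => ?_) fun e _ => edgeFactor_holley (h e) _ _)
    (pow_le_pow_right₀ one_le_two ?_) (by positivity) (Finset.prod_nonneg fun e _ => ?_)
  · exact mul_nonneg (edgeFactor_nonneg (h0 e) _) (edgeFactor_nonneg (h0' e) _)
  · rw [add_comm (numClusters (ω ⊓ η))]; exact numClusters_supermodular ω η
  · exact mul_nonneg (edgeFactor_nonneg (h0 e) _) (edgeFactor_nonneg (h0' e) _)

/-- Holley's comparison with the denominators cleared, as an instance of the four functions theorem.
-/
lemma fk_mono {J J' : G.edgeSet → ℝ} (h0 : 0 ≤ J) (h : J ≤ J') {F : Config G → ℝ}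
    (hF : Monotone F) (hF0 : 0 ≤ F) :
    (∑ ω, fkWeight J ω * F ω) * fkZ J' ≤ fkZ J * ∑ ω, fkWeight J' ω * F ω := by
  have h0' : 0 ≤ J' := h0.trans h
  refine four_functions_theorem_univ _ _ _ _ (fun ω => mul_nonneg (fkWeight_nonneg h0 ω) (hF0 ω))
    (fkWeight_nonneg h0') (fkWeight_nonneg h0)
    (fun ω => mul_nonneg (fkWeight_nonneg h0' ω) (hF0 ω)) fun ω η => ?_
  calc fkWeight J ω * F ω * fkWeight J' η = fkWeight J ω * fkWeight J' η * F ω := by ring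
    _ ≤ fkWeight J (ω ⊓ η) * fkWeight J' (ω ⊔ η) * F (ω ⊔ η) :=
        mul_le_mul (fkWeight_holley h0 h ω η) (hF le_sup_left) (hF0 ω)
          (mul_nonneg (fkWeight_nonneg h0 _) (fkWeight_nonneg h0' _))
    _ = _ := by ring

lemma fk_posCorr {J : G.edgeSet → ℝ} (h0 : 0 ≤ J) {F H : Config G → ℝ}
    (hF : Monotone F) (hF0 : 0 ≤ F) (hH : Monotone H) (hH0 : 0 ≤ H) :
    (∑ ω, fkWeight J ω * F ω) * (∑ ω, fkWeight J ω * H ω) ≤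
      fkZ J * ∑ ω, fkWeight J ω * (F ω * H ω) := by
  refine four_functions_theorem_univ _ _ _ _ (fun ω => mul_nonneg (fkWeight_nonneg h0 ω) (hF0 ω))
    (fun ω => mul_nonneg (fkWeight_nonneg h0 ω) (hH0 ω)) (fkWeight_nonneg h0)
    (fun ω => mul_nonneg (fkWeight_nonneg h0 ω) (mul_nonneg (hF0 ω) (hH0 ω))) fun ω η => ?_
  calc fkWeight J ω * F ω * (fkWeight J η * H η)
      = fkWeight J ω * fkWeight J η * (F ω * H η) := by ring
    _ ≤ fkWeight J (ω ⊓ η) * fkWeight J (ω ⊔ η) * (F (ω ⊔ η) * H (ω ⊔ η)) :=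
        mul_le_mul (fkWeight_holley h0 le_rfl ω η)
          (mul_le_mul (hF le_sup_left) (hH le_sup_right) (hH0 _) (hF0 _))
          (mul_nonneg (hF0 _) (hH0 _))
          (mul_nonneg (fkWeight_nonneg h0 _) (fkWeight_nonneg h0 _))
    _ = _ := by ring

/-- `2 ^ (k(ω ∪ {e}) - k(ω))`. -/
def clusterRatio (e : G.edgeSet) (ω : Config G) : ℝ :=
  2 ^ numClusters (Function.update ω e true) / 2 ^ numClusters ω

/-- The ratio is 1 if the endpoints of `e` are already connected and 1/2 if opening `e` merges two
clusters; more open edges favour the first case. -/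
lemma clusterRatio_mono (e : G.edgeSet) : Monotone (clusterRatio (G := G) e) := by
  intro ω η h
  unfold clusterRatio
  rw [div_le_div_iff₀ (by positivity) (by positivity), ← pow_add, ← pow_add]
  apply pow_le_pow_right₀ one_le_two
  have h1 := numClusters_supermodular (Function.update ω e true) η
  have h2 : numClusters (Function.update ω e true ⊓ η) ≤ numClusters ω :=
    numClusters_anti (le_inf (le_update_true ω e) h)
  have h3 : Function.update ω e true ⊔ η = Function.update η e true := by
    funext i
    by_cases hi : i = e
    · subst hi; simp
    · simp [Function.update_of_ne hi]
      have := h i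
      revert this
      cases ω i <;> cases η i <;> simp
  rw [h3] at h1
  omega

lemma half_le_clusterRatio (e : G.edgeSet) (ω : Config G) : 1 / 2 ≤ clusterRatio e ω := by
  unfold clusterRatio
  rw [div_le_div_iff₀ (by positivity) (by positivity), one_mul, ← pow_succ]
  exact pow_le_pow_right₀ one_le_two (numClusters_le_update_add_one ω e)

/-- The change of weight produced by raising the coupling of `e` by `D`, resampling `e`. -/
def boost (D : ℝ) (e : G.edgeSet) (ω : Config G) : ℝ :=
  Real.exp (-D) + 2 * Real.sinh D * clusterRatio e ω

lemma boost_mono {D : ℝ} (hD : 0 ≤ D) (e : G.edgeSet) : Monotone (boost (G := G) D e) := by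
  intro ω η h
  unfold boost
  have := Real.sinh_nonneg_iff.2 hD
  have := clusterRatio_mono e h
  gcongr

lemma cosh_le_boost {D : ℝ} (hD : 0 ≤ D) (e : G.edgeSet) (ω : Config G) :
    Real.cosh D ≤ boost D e ω := by
  unfold boost
  have h1 := Real.sinh_nonneg_iff.2 hD
  have h2 := mul_le_mul_of_nonneg_left (half_le_clusterRatio e ω)
    (mul_nonneg zero_le_two h1)
  have h3 := Real.cosh_sub_sinh D
  linarith

lemma one_le_boost {D : ℝ} (hD : 0 ≤ D) (e : G.edgeSet) (ω : Config G) :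
    1 ≤ boost D e ω := (Real.one_le_cosh D).trans (cosh_le_boost hD e ω)

/-- Flipping `e` is an involution. Summing over all configurations counts each pair twice, which
avoids splitting off the coordinate `e`. -/
lemma two_mul_sum_config (e : G.edgeSet) (f : Config G → ℝ) :
    2 * ∑ ω, f ω = ∑ ω, (f (Function.update ω e false) + f (Function.update ω e true)) := by
  let τ : Config G → Config G := fun ω => Function.update ω e (!ω e)
  have hτ : Function.Involutive τ := fun ω => by simp [τ]
  have h1 : ∑ ω, f (τ ω) = ∑ ω, f ω := Equiv.sum_comp hτ.toPerm f
  rw [two_mul]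
  nth_rw 2 [← h1]
  rw [← Finset.sum_add_distrib]
  refine Finset.sum_congr rfl fun ω _ => ?_
  simp only [τ]
  cases h : ω e
  · rw [← h, Function.update_eq_self]; simp [h]
  · rw [← h, Function.update_eq_self]; simp [h, add_comm]

lemma fkWeight_update (J : G.edgeSet → ℝ) (e : G.edgeSet) (c : ℝ) (ω : Config G) (o : Bool) :
    fkWeight (Function.update J e c) (Function.update ω e o) =
      edgeFactor c o * (∏ i ∈ Finset.univ.erase e, edgeFactor (J i) (ω i)) *
        2 ^ numClusters (Function.update ω e o) := by
  unfold fkWeight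
  rw [← Finset.mul_prod_erase _ _ (Finset.mem_univ e)]
  simp only [Function.update_self]
  congr 2
  refine Finset.prod_congr rfl fun i hi => ?_
  rw [Function.update_of_ne (Finset.ne_of_mem_erase hi),
    Function.update_of_ne (Finset.ne_of_mem_erase hi)]

/-- Raising a coupling by `D` amounts to adding a parallel edge of coupling `D`: it is closed with
weight `exp (-D)`, or open with weight `2 sinh D` times the cost of a possible merger. -/
lemma sum_fkWeight_update (J : G.edgeSet → ℝ) (e : G.edgeSet) (D : ℝ) (F : Config G → ℝ) :
    ∑ ω, fkWeight (Function.update J e (J e + D)) ω * F ω =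
      ∑ ω, fkWeight J ω * (Real.exp (-D) * F ω +
        2 * Real.sinh D * clusterRatio e ω * F (Function.update ω e true)) := by
  apply mul_left_cancel₀ (two_ne_zero (α := ℝ))
  rw [two_mul_sum_config e, two_mul_sum_config e]
  refine Finset.sum_congr rfl fun ω _ => ?_
  have hJ : J = Function.update J e (J e) := (Function.update_eq_self _ _).symm
  rw [fkWeight_update, fkWeight_update]
  nth_rw 5 [hJ]
  nth_rw 7 [hJ]
  rw [fkWeight_update, fkWeight_update]
  simp only [edgeFactor, clusterRatio, Function.update_idem, if_true, Bool.false_eq_true, if_false]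
  generalize (∏ i ∈ Finset.univ.erase e, edgeFactor (J i) (ω i)) = X
  have e1 : Real.exp (-(J e + D)) = Real.exp (-J e) * Real.exp (-D) := by
    rw [← Real.exp_add]; ring_nf
  have e2 : Real.sinh (J e + D) = Real.sinh (J e) * (Real.exp (-D) + 2 * Real.sinh D) +
      Real.exp (-J e) * Real.sinh D := by
    rw [Real.sinh_add, ← Real.cosh_sub_sinh, ← Real.cosh_sub_sinh]; ring
  rw [e1, e2]
  field_simp
  ring

end FiniteFK

/-! ### Sprinkling for a frozen field, and dependence of the partition function on the field. -/

section FKComparison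

variable {V : Type} [Fintype V] [DecidableEq V] {G : SimpleGraph V} [DecidableRel G.Adj]

lemma update_nonneg {J : G.edgeSet → ℝ} (h0 : 0 ≤ J) (e : G.edgeSet) {c : ℝ} (hc : 0 ≤ c) :
    0 ≤ Function.update J e c := by
  intro i
  by_cases hi : i = e
  · subst hi; simpa using hc
  · simpa [Function.update_of_ne hi] using h0 i

lemma fkZ_update (J : G.edgeSet → ℝ) (e : G.edgeSet) (D : ℝ) :
    fkZ (Function.update J e (J e + D)) = ∑ ω, fkWeight J ω * boost D e ω := by
  have := sum_fkWeight_update J e D (fun _ => 1)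
  simpa [fkZ, boost] using this

lemma tanh_nonneg {D : ℝ} (hD : 0 ≤ D) : 0 ≤ Real.tanh D := by
  rw [Real.tanh_eq_sinh_div_cosh]
  exact div_nonneg (Real.sinh_nonneg_iff.2 hD) (Real.cosh_pos D).le

lemma tanh_le_one (D : ℝ) : Real.tanh D ≤ 1 := by
  rw [Real.tanh_eq_sinh_div_cosh, div_le_one (Real.cosh_pos D)]
  exact (Real.sinh_lt_cosh D).le

/-- Raising the coupling of `e` by `D` dominates opening `e` with probability `tanh D`. -/
lemma fk_sprinkle {J : G.edgeSet → ℝ} (h0 : 0 ≤ J) {D : ℝ} (hD : 0 ≤ D) (e : G.edgeSet)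
    {F : Config G → ℝ} (hF : Monotone F) (hF0 : 0 ≤ F) :
    (∑ ω, fkWeight J ω * (F ω + Real.tanh D * (F (Function.update ω e true) - F ω))) *
        fkZ (Function.update J e (J e + D)) ≤
      fkZ J * ∑ ω, fkWeight (Function.update J e (J e + D)) ω * F ω := by
  have ht0 := tanh_nonneg hD
  have ht1 := tanh_le_one D
  have hmono : Monotone fun ω : Config G =>
      F ω + Real.tanh D * (F (Function.update ω e true) - F ω) := by
    intro ω η h
    have h1 := mul_le_mul_of_nonneg_left (hF h) (sub_nonneg.2 ht1)
    have h2 := mul_le_mul_of_nonneg_left (hF (update_true_mono h e)) ht0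
    simp only
    linarith
  have hle : ∀ ω, 0 ≤ F (Function.update ω e true) - F ω := fun ω =>
    sub_nonneg.2 (hF (le_update_true ω e))
  rw [fkZ_update, sum_fkWeight_update]
  refine (fk_posCorr h0 hmono (fun ω => add_nonneg (hF0 ω) (mul_nonneg ht0 (hle ω)))
    (boost_mono hD e) (fun ω => zero_le_one.trans (one_le_boost hD e ω))).trans ?_
  refine mul_le_mul_of_nonneg_left (Finset.sum_le_sum fun ω _ => ?_) (fkZ_pos h0).le
  refine mul_le_mul_of_nonneg_left ?_ (fkWeight_nonneg h0 ω)
  -- What remains is `((1 - tanh D) * boost - exp (-D)) * (F (ω ∪ {e}) - F ω) ≥ 0`. The value `tanh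
  -- D` is chosen so that `(1 - tanh D) cosh D = exp (-D)`, and `cosh D` is the lower bound of
  -- `boost`.
  have key : Real.exp (-D) ≤ (1 - Real.tanh D) * boost D e ω := by
    refine le_trans (le_of_eq ?_) (mul_le_mul_of_nonneg_left (cosh_le_boost hD e ω)
      (sub_nonneg.2 ht1))
    rw [Real.tanh_eq_sinh_div_cosh, ← Real.cosh_sub_sinh]
    field_simp [(Real.cosh_pos D).ne']
  have := mul_le_mul_of_nonneg_right key (hle ω)
  have hb : 2 * Real.sinh D * clusterRatio e ω = boost D e ω - Real.exp (-D) := by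
    unfold boost; ring
  rw [hb]
  linarith

lemma fkZ_le_update {J : G.edgeSet → ℝ} (h0 : 0 ≤ J) {D : ℝ} (hD : 0 ≤ D) (e : G.edgeSet) :
    fkZ J ≤ fkZ (Function.update J e (J e + D)) := by
  rw [fkZ_update]
  exact Finset.sum_le_sum fun ω _ =>
    le_mul_of_one_le_right (fkWeight_nonneg h0 ω) (one_le_boost hD e ω)

lemma piecewise_nonneg {J J' : G.edgeSet → ℝ} (h0 : 0 ≤ J) (h0' : 0 ≤ J')
    (S : Finset G.edgeSet) : 0 ≤ S.piecewise J' J :=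
  Finset.le_piecewise_of_le_of_le _ h0' h0

lemma fkZ_mono {J J' : G.edgeSet → ℝ} (h0 : 0 ≤ J) (h : J ≤ J') : fkZ J ≤ fkZ J' := by
  suffices H : ∀ S : Finset G.edgeSet, fkZ J ≤ fkZ (S.piecewise J' J) by
    simpa using H Finset.univ
  intro S
  induction S using Finset.induction_on with
  | empty => simp
  | insert e S he ih =>
    refine ih.trans ?_
    rw [Finset.piecewise_insert]
    have h1 : J' e = S.piecewise J' J e + (J' e - J e) := by
      rw [Finset.piecewise_eq_of_notMem _ _ _ he]; ring
    rw [h1]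
    exact fkZ_le_update (piecewise_nonneg h0 (h0.trans h) S) (sub_nonneg.2 (h e)) e

/-- The ratio of partition functions before and after the raise is the mean of the increasing
function `boost`, and that mean increases with the couplings. -/
lemma fkZ_update_mul_le {A B : G.edgeSet → ℝ} (h0 : 0 ≤ A) (h : A ≤ B) {D : ℝ} (hD : 0 ≤ D)
    (e : G.edgeSet) : fkZ (Function.update A e (A e + D)) * fkZ B ≤
      fkZ A * fkZ (Function.update B e (B e + D)) := by
  rw [fkZ_update, fkZ_update]
  exact fk_mono h0 h (boost_mono hD e) fun ω => zero_le_one.trans (one_le_boost hD e ω)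

/-- The increment `D` is added edge by edge and the one-edge ratios are multiplied. -/
lemma fkZ_add_mul_le {A B D : G.edgeSet → ℝ} (h0 : 0 ≤ A) (h : A ≤ B) (hD : 0 ≤ D) :
    fkZ (A + D) * fkZ B ≤ fkZ A * fkZ (B + D) := by
  suffices H : ∀ S : Finset G.edgeSet, fkZ (S.piecewise (A + D) A) * fkZ B ≤
      fkZ A * fkZ (S.piecewise (B + D) B) by
    simpa using H Finset.univ
  intro S
  have h0B := h0.trans h
  induction S using Finset.induction_on with
  | empty => simp
  | insert e S he ih =>
    have hA : (A + D) e = S.piecewise (A + D) A e + D e := by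
      rw [Finset.piecewise_eq_of_notMem _ _ _ he]; rfl
    have hB : (B + D) e = S.piecewise (B + D) B e + D e := by
      rw [Finset.piecewise_eq_of_notMem _ _ _ he]; rfl
    rw [Finset.piecewise_insert, Finset.piecewise_insert, hA, hB]
    set A' := S.piecewise (A + D) A
    set B' := S.piecewise (B + D) B
    have hA' : 0 ≤ A' := piecewise_nonneg h0 (add_nonneg h0 hD) S
    have hAB : A' ≤ B' := by
      intro i
      by_cases hi : i ∈ S
      · simpa [A', B', hi] using h i
      · simpa [A', B', hi] using h i
    have hstep := fkZ_update_mul_le hA' hAB (hD e) e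
    have pA := fkZ_pos hA'
    have pB := fkZ_pos (hA'.trans hAB)
    have q0 : 0 ≤ fkZ B := (fkZ_pos h0B).le
    have q1 : 0 ≤ fkZ (Function.update B' e (B' e + D e)) :=
      (fkZ_pos (update_nonneg (hA'.trans hAB) e
        (add_nonneg ((hA'.trans hAB) e) (hD e)))).le
    rw [← mul_le_mul_iff_left₀ (mul_pos pA pB)]
    have := mul_le_mul hstep ih (mul_nonneg pA.le q0) (mul_nonneg pA.le q1)
    linarith

/-- `s_x s_y` for `e = xy`. -/
def pairProd (s : V → ℝ≥0) (e : Sym2 V) : ℝ := ((e.map s).mul : ℝ≥0)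

lemma pairProd_mk (s : V → ℝ≥0) (x y : V) : pairProd s s(x, y) = s x * s y := by
  simp [pairProd]

lemma pairProd_nonneg (s : V → ℝ≥0) (e : Sym2 V) : 0 ≤ pairProd s e := NNReal.coe_nonneg _

lemma pairProd_mono (e : Sym2 V) : Monotone fun s => pairProd s e := by
  intro s t h
  induction e using Sym2.ind with
  | _ x y =>
  simp only [pairProd_mk]
  exact mul_le_mul (NNReal.coe_le_coe.2 (h x)) (NNReal.coe_le_coe.2 (h y)) (NNReal.coe_nonneg _)
    (NNReal.coe_nonneg _)

lemma pairProd_supermodular (s t : V → ℝ≥0) (e : Sym2 V) :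
    pairProd s e + pairProd t e ≤ pairProd (s ⊓ t) e + pairProd (s ⊔ t) e := by
  induction e using Sym2.ind with
  | _ x y =>
  simp only [pairProd_mk, Pi.inf_apply, Pi.sup_apply]
  rcases le_total (s x) (t x) with h | h <;> rcases le_total (s y) (t y) with h' | h' <;>
    simp only [inf_of_le_left h, sup_of_le_right h, inf_of_le_left h', sup_of_le_right h',
      inf_of_le_right h, sup_of_le_left h, inf_of_le_right h', sup_of_le_left h'] <;>
    have h1 := NNReal.coe_le_coe.2 h <;> have h2 := NNReal.coe_le_coe.2 h' <;>
    nlinarith [mul_nonneg (sub_nonneg.2 h1) (sub_nonneg.2 h2)]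

/-- The couplings `b_e s_x s_y`. -/
def coupling (b : G.edgeSet → ℝ) (s : V → ℝ≥0) : G.edgeSet → ℝ := fun e => b e * pairProd s e

lemma coupling_nonneg {b : G.edgeSet → ℝ} (hb : 0 ≤ b) (s : V → ℝ≥0) : 0 ≤ coupling b s :=
  fun e => mul_nonneg (hb e) (pairProd_nonneg s e)

lemma coupling_mono {b : G.edgeSet → ℝ} (hb : 0 ≤ b) : Monotone (coupling b) :=
  fun _ _ h e => mul_le_mul_of_nonneg_left (pairProd_mono e h) (hb e)

lemma coupling_mono_left {b b' : G.edgeSet → ℝ} (h : b ≤ b') (s : V → ℝ≥0) :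
    coupling b s ≤ coupling b' s :=
  fun e => mul_le_mul_of_nonneg_right (h e) (pairProd_nonneg s e)

/-- Hypothesis of the four functions theorem for the densities of the field under `b` and `b'`. The
increment from `s ⊓ t` to `s` is transferred onto `t`; by supermodularity of `s_x s_y` and `b ≤ b'`,
the result stays below the couplings of `s ⊔ t`. -/
lemma fkZ_coupling_four {b b' : G.edgeSet → ℝ} (hb : 0 ≤ b) (hbb : b ≤ b') (s t : V → ℝ≥0) :
    fkZ (coupling b s) * fkZ (coupling b' t) ≤
      fkZ (coupling b (s ⊓ t)) * fkZ (coupling b' (s ⊔ t)) := by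
  have hb' := hb.trans hbb
  have hD : 0 ≤ coupling b s - coupling b (s ⊓ t) :=
    sub_nonneg.2 (coupling_mono hb inf_le_left)
  have h1 := fkZ_add_mul_le (coupling_nonneg hb (s ⊓ t))
    ((coupling_mono hb inf_le_right).trans (coupling_mono_left hbb t)) hD
  rw [add_sub_cancel] at h1
  refine h1.trans (mul_le_mul_of_nonneg_left (fkZ_mono
    (add_nonneg (coupling_nonneg hb' t) hD) fun e => ?_) (fkZ_pos (coupling_nonneg hb _)).le)
  simp only [coupling, Pi.add_apply, Pi.sub_apply]
  have h2 := pairProd_supermodular s t e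
  have h3 := pairProd_mono (e : Sym2 V) (show s ⊓ t ≤ s from inf_le_left)
  simp only at h3
  have h4 := mul_le_mul_of_nonneg_right (hbb e) (sub_nonneg.2 h3)
  have h5 := mul_le_mul_of_nonneg_left h2 (hb' e)
  linarith

lemma fk_coupling_mono {b : G.edgeSet → ℝ} (hb : 0 ≤ b) {F : Config G → ℝ}
    (hF : Monotone F) (hF0 : 0 ≤ F) :
    Monotone fun s => (∑ ω, fkWeight (coupling b s) ω * F ω) / fkZ (coupling b s) := by
  intro s t h
  simp only
  rw [div_le_div_iff₀ (fkZ_pos (coupling_nonneg hb s)) (fkZ_pos (coupling_nonneg hb t)),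
    mul_comm _ (fkZ (coupling b s))]
  exact fk_mono (coupling_nonneg hb s) (coupling_mono hb h) hF hF0

@[fun_prop]
lemma measurable_pairProd (e : Sym2 V) : Measurable fun s => pairProd s e := by
  induction e using Sym2.ind with
  | _ x y => simp only [pairProd_mk]; fun_prop

lemma measurable_edgeFactor (o : Bool) : Measurable fun J => edgeFactor J o := by
  cases o <;> simp only [edgeFactor, if_true, Bool.false_eq_true, if_false] <;> fun_prop

@[fun_prop]
lemma measurable_fkWeight (b : G.edgeSet → ℝ) (ω : Config G) :
    Measurable fun s => fkWeight (coupling b s) ω := by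
  refine Measurable.mul_const (Finset.measurable_prod _ fun e _ => ?_) _
  exact (measurable_edgeFactor (ω e)).comp ((measurable_pairProd (e : Sym2 V)).const_mul (b e))

@[fun_prop]
lemma measurable_fkZ (b : G.edgeSet → ℝ) : Measurable fun s => fkZ (coupling b s) :=
  Finset.measurable_sum _ fun ω _ => measurable_fkWeight b ω

end FKComparison

/-! ### Four functions theorem for product measures. -/

section FourFunctions

/-- For finite values, `c (c + d - a - b) ≥ c² + ab - ca - cb = (c - a)(c - b) ≥ 0`. -/
lemma ennreal_add_le_add_of_mul_le {a b c d : ℝ≥0∞} (h1 : a ≤ c) (h2 : b ≤ c)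
    (h3 : a * b ≤ c * d) : a + b ≤ c + d := by
  rcases eq_or_ne c ∞ with rfl | hc
  · simp
  rcases eq_or_ne d ∞ with rfl | hd
  · simp
  have ha := ne_top_of_le_ne_top hc h1
  have hb := ne_top_of_le_ne_top hc h2
  lift a to ℝ≥0 using ha
  lift b to ℝ≥0 using hb
  lift c to ℝ≥0 using hc
  lift d to ℝ≥0 using hd
  norm_cast at *
  rcases eq_zero_or_pos c with rfl | hc
  · simp_all
  have h1 : (a : ℝ) ≤ c := h1
  have h2 : (b : ℝ) ≤ c := h2
  have h3 : (a : ℝ) * b ≤ c * d := by exact_mod_cast h3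
  have hc : (0 : ℝ) < c := hc
  have : (a : ℝ) + b ≤ c + d := by
    refine le_of_mul_le_mul_left ?_ hc
    nlinarith [mul_nonneg (sub_nonneg.2 h1) (sub_nonneg.2 h2)]
  exact_mod_cast this

lemma lintegral_four_functions_linear {α : Type*} [LinearOrder α] [MeasurableSpace α]
    (μ : Measure α) [SFinite μ] {f₁ f₂ f₃ f₄ : α → ℝ≥0∞} (h₁ : Measurable f₁)
    (h₂ : Measurable f₂) (h₃ : Measurable f₃) (h₄ : Measurable f₄)
    (h : ∀ x y, f₁ x * f₂ y ≤ f₃ (x ⊓ y) * f₄ (x ⊔ y)) :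
    (∫⁻ x, f₁ x ∂μ) * ∫⁻ x, f₂ x ∂μ ≤ (∫⁻ x, f₃ x ∂μ) * ∫⁻ x, f₄ x ∂μ := by
  -- Symmetrising the double integral in `(x, y)` leaves a two-point inequality for the pair `{x,
  -- y}`, in which one may take `x ≤ y`.
  have expand : ∀ {f g : α → ℝ≥0∞}, Measurable f → Measurable g →
      2 * ((∫⁻ x, f x ∂μ) * ∫⁻ x, g x ∂μ) = ∫⁻ x, ∫⁻ y, (f x * g y + f y * g x) ∂μ ∂μ := by
    intro f g hf hg
    have e1 : ∀ x, ∫⁻ y, (f x * g y + f y * g x) ∂μ =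
        f x * (∫⁻ y, g y ∂μ) + (∫⁻ y, f y ∂μ) * g x := fun x => by
      rw [lintegral_add_left (hg.const_mul _), lintegral_const_mul _ hg, lintegral_mul_const _ hf]
    simp_rw [e1]
    rw [lintegral_add_left (hf.mul_const _), lintegral_mul_const _ hf, lintegral_const_mul _ hg,
      two_mul]
  have key : ∀ x y, x ≤ y → f₁ x * f₂ y + f₁ y * f₂ x ≤ f₃ x * f₄ y + f₃ y * f₄ x := by
    intro x y hxy
    have a1 := h x y
    have a2 := h y x
    have a3 := h x x
    have a4 := h y y
    simp only [inf_of_le_left hxy, sup_of_le_right hxy, inf_of_le_right hxy, sup_of_le_left hxy,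
      inf_idem, sup_idem] at a1 a2 a3 a4
    refine ennreal_add_le_add_of_mul_le a1 a2 ?_
    calc f₁ x * f₂ y * (f₁ y * f₂ x) = f₁ x * f₂ x * (f₁ y * f₂ y) := by ring
      _ ≤ f₃ x * f₄ x * (f₃ y * f₄ y) := mul_le_mul' a3 a4
      _ = _ := by ring
  rw [← ENNReal.mul_le_mul_iff_right (a := 2) (by simp) (by simp), expand h₁ h₂, expand h₃ h₄]
  refine lintegral_mono fun x => lintegral_mono fun y => ?_
  rcases le_total x y with hxy | hxy
  · exact key x y hxy
  · simpa only [add_comm] using key y x hxy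

variable {ι α : Type*} [Fintype ι] [DecidableEq ι] [LinearOrder α] [MeasurableSpace α]

/-- The four functions theorem for a product of measures on a linear order. -/
lemma lintegral_four_functions (μ : ι → Measure α) [∀ i, SigmaFinite (μ i)]
    {f₁ f₂ f₃ f₄ : (ι → α) → ℝ≥0∞} (h₁ : Measurable f₁)
    (h₂ : Measurable f₂) (h₃ : Measurable f₃) (h₄ : Measurable f₄)
    (h : ∀ x y, f₁ x * f₂ y ≤ f₃ (x ⊓ y) * f₄ (x ⊔ y)) :
    (∫⁻ x, f₁ x ∂Measure.pi μ) * ∫⁻ x, f₂ x ∂Measure.pi μ ≤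
      (∫⁻ x, f₃ x ∂Measure.pi μ) * ∫⁻ x, f₄ x ∂Measure.pi μ := by
  -- The hypothesis survives integrating out one coordinate, by the linear-order case.
  have main : ∀ s : Finset ι, ∀ x y, (∫⋯∫⁻_s, f₁ ∂μ) x * (∫⋯∫⁻_s, f₂ ∂μ) y ≤
      (∫⋯∫⁻_s, f₃ ∂μ) (x ⊓ y) * (∫⋯∫⁻_s, f₄ ∂μ) (x ⊔ y) := by
    intro s
    induction s using Finset.induction_on with
    | empty => simpa using h
    | insert i s hi ih =>
      intro x y
      rw [lmarginal_insert _ h₁ hi, lmarginal_insert _ h₂ hi, lmarginal_insert _ h₃ hi,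
        lmarginal_insert _ h₄ hi]
      have hm : ∀ {f : (ι → α) → ℝ≥0∞} (z : ι → α), Measurable f →
          Measurable fun u => (∫⋯∫⁻_s, f ∂μ) (Function.update z i u) := fun z hf =>
        (hf.lmarginal μ).comp (measurable_update z)
      refine lintegral_four_functions_linear (μ i) (hm x h₁) (hm y h₂) (hm _ h₃) (hm _ h₄)
        fun u v => (ih _ _).trans (le_of_eq ?_)
      congr 2
      · funext j
        by_cases hj : j = i
        · subst hj; simp
        · simp [Function.update_of_ne hj]
      · funext j
        by_cases hj : j = i
        · subst hj; simp
        · simp [Function.update_of_ne hj]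
  rcases isEmpty_or_nonempty (ι → α) with he | ⟨⟨z⟩⟩
  · simp [Measure.eq_zero_of_isEmpty]
  · have := main Finset.univ z z
    simpa only [lmarginal_univ] using this

end FourFunctions

/-! ### One-site estimates by integration by parts against the quartic weight. -/

section OneDim

open Filter Asymptotics Topology Set

/-- At most exponential growth at `+∞`. -/
def ExpGrowth (h : ℝ → ℝ) : Prop := ∃ c : ℝ, h =O[atTop] fun s => Real.exp (c * s)

lemma exp_isBigO_of_le {c c' : ℝ} (h : c ≤ c') :
    (fun s : ℝ => Real.exp (c * s)) =O[atTop] fun s => Real.exp (c' * s) := by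
  refine IsBigO.of_bound 1 ((eventually_ge_atTop 0).mono fun s hs => ?_)
  simp only [Real.norm_eq_abs, Real.abs_exp, one_mul]
  exact Real.exp_le_exp.2 (mul_le_mul_of_nonneg_right h hs)

lemma ExpGrowth.add {h k : ℝ → ℝ} (hh : ExpGrowth h) (hk : ExpGrowth k) :
    ExpGrowth fun s => h s + k s := by
  obtain ⟨c, hc⟩ := hh
  obtain ⟨d, hd⟩ := hk
  exact ⟨max c d, (hc.trans (exp_isBigO_of_le (le_max_left c d))).add
    (hd.trans (exp_isBigO_of_le (le_max_right c d)))⟩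

lemma ExpGrowth.mul {h k : ℝ → ℝ} (hh : ExpGrowth h) (hk : ExpGrowth k) :
    ExpGrowth fun s => h s * k s := by
  obtain ⟨c, hc⟩ := hh
  obtain ⟨d, hd⟩ := hk
  refine ⟨c + d, (hc.mul hd).trans (IsBigO.of_bound 1 (Eventually.of_forall fun s => ?_))⟩
  rw [← Real.exp_add, ← add_mul, one_mul]

lemma ExpGrowth.neg {h : ℝ → ℝ} (hh : ExpGrowth h) : ExpGrowth fun s => -h s := by
  obtain ⟨c, hc⟩ := hh
  exact ⟨c, hc.neg_left⟩

lemma ExpGrowth.of_le {h k : ℝ → ℝ} (hk : ExpGrowth k) (hle : ∀ s, 1 ≤ s → |h s| ≤ k s) :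
    ExpGrowth h := by
  obtain ⟨c, hc⟩ := hk
  refine ⟨c, IsBigO.trans (IsBigO.of_bound 1 ((eventually_ge_atTop 1).mono fun s hs => ?_)) hc⟩
  rw [one_mul]
  exact (hle s hs).trans (le_abs_self _)

lemma expGrowth_exp (c : ℝ) : ExpGrowth fun s => Real.exp (c * s) := ⟨c, isBigO_refl _ _⟩

lemma expGrowth_pow (n : ℕ) : ExpGrowth fun s => s ^ n :=
  ⟨1, by simpa using (Real.isLittleO_pow_exp_atTop (n := n)).isBigO⟩

lemma expGrowth_const (C : ℝ) : ExpGrowth fun _ => C :=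
  ⟨0, by simpa using isBigO_const_const C (one_ne_zero (α := ℝ)) atTop⟩

lemma expGrowth_id : ExpGrowth fun s => s := by simpa using expGrowth_pow 1

/-- The quartic weight. -/
def quartic (g a s : ℝ) : ℝ := Real.exp (-g * s ^ 4 - a * s ^ 2)

lemma quartic_pos (g a s : ℝ) : 0 < quartic g a s := Real.exp_pos _

@[fun_prop]
lemma continuous_quartic (g a : ℝ) : Continuous (quartic g a) := by unfold quartic; fun_prop

lemma hasDerivAt_quartic (g a s : ℝ) :
    HasDerivAt (quartic g a) (-(4 * g * s ^ 3 + 2 * a * s) * quartic g a s) s := by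
  have h1 : HasDerivAt (fun s : ℝ => -g * s ^ 4 - a * s ^ 2)
      (-g * (4 * s ^ 3) - a * (2 * s)) s := by
    have := ((hasDerivAt_pow 4 s).const_mul (-g)).sub ((hasDerivAt_pow 2 s).const_mul a)
    exact this.congr_deriv (by norm_num)
  have h2 := h1.exp
  unfold quartic
  exact h2.congr_deriv (by ring)

lemma quartic_isBigO {g : ℝ} (hg : 0 < g) (a c : ℝ) :
    quartic g a =O[atTop] fun s => Real.exp (-c * s) := by
  let m := |a| + |c|
  refine IsBigO.of_bound (Real.exp (m ^ 2 / (4 * g) + |c|)) (Eventually.of_forall fun s => ?_)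
  simp only [quartic, Real.norm_eq_abs, Real.abs_exp]
  rw [← Real.exp_add]
  refine Real.exp_le_exp.2 ?_
  have h1 : m * s ^ 2 ≤ g * s ^ 4 + m ^ 2 / (4 * g) := by
    have : g * s ^ 4 + m ^ 2 / (4 * g) - m * s ^ 2 = g * (s ^ 2 - m / (2 * g)) ^ 2 := by
      field_simp; ring
    nlinarith [mul_nonneg hg.le (sq_nonneg (s ^ 2 - m / (2 * g)))]
  have h2 : c * s ≤ |c| * (1 + s ^ 2) := by
    refine (le_abs_self _).trans ?_
    rw [abs_mul]
    refine mul_le_mul_of_nonneg_left ?_ (abs_nonneg c)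
    nlinarith [sq_abs s, sq_nonneg (|s| - 1)]
  have h3 : -a * s ^ 2 ≤ |a| * s ^ 2 :=
    mul_le_mul_of_nonneg_right (neg_le_abs a) (sq_nonneg s)
  simp only [m] at h1 ⊢
  nlinarith

lemma ExpGrowth.mul_quartic_isBigO {h : ℝ → ℝ} (hh : ExpGrowth h) {g : ℝ} (hg : 0 < g) (a : ℝ) :
    (fun s => h s * quartic g a s) =O[atTop] fun s => Real.exp (-1 * s) := by
  obtain ⟨c, hc⟩ := hh
  refine (hc.mul (quartic_isBigO hg a (c + 1))).congr_right fun s => ?_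
  rw [← Real.exp_add]
  ring_nf

lemma ExpGrowth.integrableOn {h : ℝ → ℝ} (hh : ExpGrowth h) (hc : ContinuousOn h (Ici 0))
    {g : ℝ} (hg : 0 < g) (a : ℝ) : IntegrableOn (fun s => h s * quartic g a s) (Ioi 0) :=
  integrable_of_isBigO_exp_neg one_pos (hc.mul (continuous_quartic g a).continuousOn)
    (hh.mul_quartic_isBigO hg a)

lemma ExpGrowth.tendsto {h : ℝ → ℝ} (hh : ExpGrowth h) {g : ℝ} (hg : 0 < g) (a : ℝ) :
    Tendsto (fun s => h s * quartic g a s) atTop (𝓝 0) := by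
  refine (hh.mul_quartic_isBigO hg a).trans_tendsto ?_
  simpa using Real.tendsto_exp_neg_atTop_nhds_zero

/-- Integration by parts against the quartic weight, as an inequality. -/
lemma lintegral_quartic_le {g : ℝ} (hg : 0 < g) (a : ℝ) {u u' A B : ℝ → ℝ}
    (hu : ContinuousOn u (Ici 0)) (hu0 : u 0 = 0) (hd : ∀ s, 0 < s → HasDerivAt u (u' s) s)
    (hu' : ContinuousOn u' (Ici 0)) (eu : ExpGrowth u) (eu' : ExpGrowth u')
    (hB : ContinuousOn B (Ici 0)) (eB : ExpGrowth B) (hA0 : ∀ s, 0 < s → 0 ≤ A s)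
    (hB0 : ∀ s, 0 < s → 0 ≤ B s)
    (hle : ∀ s, 0 < s → u' s - u s * (4 * g * s ^ 3 + 2 * a * s) ≤ B s - A s) :
    ∫⁻ s in Ioi (0 : ℝ), ENNReal.ofReal (A s * quartic g a s) ≤
      ∫⁻ s in Ioi (0 : ℝ), ENNReal.ofReal (B s * quartic g a s) := by
  let v : ℝ → ℝ := fun s => (u' s - u s * (4 * g * s ^ 3 + 2 * a * s)) * quartic g a s
  have epoly : ExpGrowth fun s => 4 * g * s ^ 3 + 2 * a * s :=
    ((expGrowth_const _).mul (expGrowth_pow 3)).add ((expGrowth_const _).mul expGrowth_id)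
  have ev : ExpGrowth fun s => u' s - u s * (4 * g * s ^ 3 + 2 * a * s) := by
    simpa only [sub_eq_add_neg] using eu'.add (eu.mul epoly).neg
  have iv : IntegrableOn v (Ioi 0) := ev.integrableOn
    (hu'.sub (hu.mul (Continuous.continuousOn (by fun_prop)))) hg a
  -- `v` is the derivative of `u * quartic`, which vanishes at 0 and at infinity.
  have hv : ∫ s in Ioi (0 : ℝ), v s = 0 := by
    have := integral_Ioi_of_hasDerivAt_of_tendsto (a := 0) (m := 0)
      (f := fun s => u s * quartic g a s) (f' := v)
      ((hu.mul (continuous_quartic g a).continuousOn) 0 self_mem_Ici) (fun s hs => by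
        have := (hd s hs).mul (hasDerivAt_quartic g a s)
        exact this.congr_deriv (by simp only [v]; ring)) iv (eu.tendsto hg a)
    simpa [hu0] using this
  have iB : IntegrableOn (fun s => B s * quartic g a s) (Ioi 0) := eB.integrableOn hB hg a
  have hAB : ∀ s, 0 < s → A s * quartic g a s ≤ B s * quartic g a s - v s := fun s hs => by
    have := mul_le_mul_of_nonneg_right (hle s hs) (quartic_pos g a s).le
    simp only [v]
    linarith
  have hA : ∀ s, 0 < s → 0 ≤ A s * quartic g a s := fun s hs =>
    mul_nonneg (hA0 s hs) (quartic_pos g a s).le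
  calc ∫⁻ s in Ioi (0 : ℝ), ENNReal.ofReal (A s * quartic g a s)
      ≤ ∫⁻ s in Ioi (0 : ℝ), ENNReal.ofReal (B s * quartic g a s - v s) :=
        setLIntegral_mono' measurableSet_Ioi fun s hs => ENNReal.ofReal_le_ofReal (hAB s hs)
    _ = ENNReal.ofReal (∫ s in Ioi (0 : ℝ), (B s * quartic g a s - v s)) :=
        (ofReal_integral_eq_lintegral_ofReal (iB.sub iv)
          ((ae_restrict_mem measurableSet_Ioi).mono fun s hs => (hA s hs).trans (hAB s hs))).symm
    _ = ENNReal.ofReal (∫ s in Ioi (0 : ℝ), B s * quartic g a s) := by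
        rw [integral_sub iB iv, hv, sub_zero]
    _ = _ := ofReal_integral_eq_lintegral_ofReal iB
        ((ae_restrict_mem measurableSet_Ioi).mono fun s hs =>
          mul_nonneg (hB0 s hs) (quartic_pos g a s).le)

variable {ι : Type*}

lemma edgeFactor_le {J : ℝ} (hJ : 0 ≤ J) (o : Bool) : edgeFactor J o ≤ 2 * Real.exp J := by
  have h1 : Real.exp (-J) ≤ Real.exp J := Real.exp_le_exp.2 (by linarith)
  have h2 := Real.exp_pos (-J)
  cases o
  · simp only [edgeFactor, Bool.false_eq_true, if_false]; linarith
  · simp only [edgeFactor, if_true, Real.sinh_eq]; linarith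

/-- The logarithmic derivative of an edge factor is controlled for both edge states. The upper bound
carries a factor `s` because `coth` blows up at 0; for an open edge it follows from `t cosh t = t
sinh t + t exp (-t)` and `t ≤ sinh t`. -/
lemma exists_deriv_edgeFactor {κ : ℝ} (hκ : 0 ≤ κ) (o : Bool) : ∃ φ' : ℝ → ℝ, Continuous φ' ∧
    (∀ s, HasDerivAt (fun s => edgeFactor (κ * s) o) (φ' s) s) ∧
    ∀ s, 0 ≤ s → s * φ' s ≤ (1 + s * κ) * edgeFactor (κ * s) o ∧
      -κ * edgeFactor (κ * s) o ≤ φ' s := by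
  have hlin : ∀ s, HasDerivAt (fun s => κ * s) κ s := fun s => by
    simpa using (hasDerivAt_id s).const_mul κ
  cases o
  · refine ⟨fun s => -κ * Real.exp (-(κ * s)), by fun_prop, fun s => ?_, fun s hs => ?_⟩
    · simp only [edgeFactor, Bool.false_eq_true, if_false]
      have := (hlin s).neg.exp
      rw [mul_comm] at this
      exact this
    · simp only [edgeFactor, Bool.false_eq_true, if_false, le_refl, and_true]
      have := Real.exp_pos (-(κ * s))
      have := mul_nonneg hs hκ
      nlinarith
  · refine ⟨fun s => 2 * (κ * Real.cosh (κ * s)), by fun_prop, fun s => ?_, fun s hs => ?_⟩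
    · simp only [edgeFactor, if_true]
      have := (hlin s).sinh.const_mul 2
      rw [mul_comm κ]
      exact this
    · simp only [edgeFactor, if_true]
      have ht : 0 ≤ κ * s := mul_nonneg hκ hs
      have h1 : Real.exp (-(κ * s)) ≤ 1 := Real.exp_le_one_iff.2 (by linarith)
      have h2 := Real.self_le_sinh_iff.2 ht
      have h3 := Real.cosh_sub_sinh (κ * s)
      have h4 : κ * s * Real.cosh (κ * s) ≤ (1 + κ * s) * Real.sinh (κ * s) := by nlinarith
      have h5 := Real.sinh_nonneg_iff.2 ht
      have h6 := Real.cosh_pos (κ * s)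
      refine ⟨by linarith, ?_⟩
      have h7 : 0 ≤ κ * Real.cosh (κ * s) := by positivity
      have h8 : 0 ≤ κ * Real.sinh (κ * s) := by positivity
      linarith

/-- The product of the factors of the edges at a vertex, as a function of the field there. -/
def starFactor (S : Finset ι) (κ : ι → ℝ) (o : ι → Bool) (s : ℝ) : ℝ :=
  ∏ i ∈ S, edgeFactor (κ i * s) (o i)

lemma starFactor_nonneg (S : Finset ι) {κ : ι → ℝ} (hκ : 0 ≤ κ) (o : ι → Bool) {s : ℝ}
    (hs : 0 ≤ s) : 0 ≤ starFactor S κ o s :=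
  Finset.prod_nonneg fun i _ => edgeFactor_nonneg (mul_nonneg (hκ i) hs) _

lemma exists_deriv_starFactor (S : Finset ι) {κ : ι → ℝ} (hκ : 0 ≤ κ) (o : ι → Bool) :
    ∃ φ' : ℝ → ℝ, Continuous φ' ∧ (∀ s, HasDerivAt (starFactor S κ o) (φ' s) s) ∧
      ∀ s, 0 ≤ s → s * φ' s ≤ (S.card + s * ∑ i ∈ S, κ i) * starFactor S κ o s ∧
        -(∑ i ∈ S, κ i) * starFactor S κ o s ≤ φ' s := by
  classical
  induction S using Finset.induction_on with
  | empty =>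
    refine ⟨fun _ => 0, continuous_const, fun s => ?_, fun s _ => by simp⟩
    have : starFactor ∅ κ o = fun _ => (1 : ℝ) := by funext s; simp [starFactor]
    rw [this]
    exact hasDerivAt_const s 1
  | insert i S hi ih =>
    obtain ⟨ψ, hψc, hψd, hψ⟩ := ih
    obtain ⟨χ, hχc, hχd, hχ⟩ := exists_deriv_edgeFactor (hκ i) (o i)
    have heq : starFactor (insert i S) κ o =
        fun s => edgeFactor (κ i * s) (o i) * starFactor S κ o s := by
      funext s
      simp only [starFactor, Finset.prod_insert hi]
    have c1 : Continuous fun s => edgeFactor (κ i * s) (o i) :=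
      continuous_iff_continuousAt.2 fun s => (hχd s).continuousAt
    have c2 : Continuous (starFactor S κ o) :=
      continuous_iff_continuousAt.2 fun s => (hψd s).continuousAt
    refine ⟨fun s => χ s * starFactor S κ o s + edgeFactor (κ i * s) (o i) * ψ s, by fun_prop,
      fun s => ?_, fun s hs => ?_⟩
    · rw [heq]
      exact (hχd s).mul (hψd s)
    · rw [heq, Finset.sum_insert hi, Finset.card_insert_of_notMem hi]
      have n1 := edgeFactor_nonneg (mul_nonneg (hκ i) hs) (o i)
      have n2 := starFactor_nonneg S hκ o hs
      obtain ⟨p1, p2⟩ := hχ s hs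
      obtain ⟨q1, q2⟩ := hψ s hs
      have r1 := mul_le_mul_of_nonneg_right p1 n2
      have r2 := mul_le_mul_of_nonneg_right p2 n2
      have r3 := mul_le_mul_of_nonneg_left q1 n1
      have r4 := mul_le_mul_of_nonneg_left q2 n1
      push_cast
      constructor <;> linarith

lemma expGrowth_starFactor (S : Finset ι) {κ : ι → ℝ} (hκ : 0 ≤ κ) (o : ι → Bool) :
    ExpGrowth (starFactor S κ o) := by
  classical
  induction S using Finset.induction_on with
  | empty =>
    have : starFactor ∅ κ o = fun _ => (1 : ℝ) := by funext s; simp [starFactor]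
    rw [this]
    exact expGrowth_const 1
  | insert i S hi ih =>
    have : ExpGrowth fun s => edgeFactor (κ i * s) (o i) :=
      ((expGrowth_const 2).mul (expGrowth_exp (κ i))).of_le fun s hs => by
        have h0 := mul_nonneg (hκ i) (zero_le_one.trans hs)
        rw [abs_of_nonneg (edgeFactor_nonneg h0 _)]
        exact edgeFactor_le h0 _
    have heq : starFactor (insert i S) κ o =
        fun s => edgeFactor (κ i * s) (o i) * starFactor S κ o s := by
      funext s
      simp only [starFactor, Finset.prod_insert hi]
    rw [heq]
    exact this.mul ih

lemma expGrowth_deriv_starFactor (S : Finset ι) {κ : ι → ℝ} (hκ : 0 ≤ κ) (o : ι → Bool)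
    {φ' : ℝ → ℝ} (h : ∀ s, 0 ≤ s →
      s * φ' s ≤ (S.card + s * ∑ i ∈ S, κ i) * starFactor S κ o s ∧
        -(∑ i ∈ S, κ i) * starFactor S κ o s ≤ φ' s) : ExpGrowth φ' := by
  have e := (((expGrowth_const (S.card : ℝ)).add (expGrowth_id.mul
    (expGrowth_const (∑ i ∈ S, κ i)))).add (expGrowth_const (∑ i ∈ S, κ i))).mul
    (expGrowth_starFactor S hκ o)
  refine e.of_le fun s hs => ?_
  have hs0 : 0 ≤ s := zero_le_one.trans hs
  obtain ⟨h1, h2⟩ := h s hs0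
  have n1 := starFactor_nonneg S hκ o hs0
  have n2 : 0 ≤ ∑ i ∈ S, κ i := Finset.sum_nonneg fun i _ => hκ i
  have n3 : 0 ≤ (∑ i ∈ S, κ i) * starFactor S κ o s := mul_nonneg n2 n1
  have n4 : 0 ≤ (S.card + s * ∑ i ∈ S, κ i) * starFactor S κ o s := by positivity
  rw [abs_le]
  constructor
  · linarith
  · rcases le_total 0 (φ' s) with hp | hp
    · have := le_mul_of_one_le_left hp hs
      linarith
    · linarith

/-- Fourth moment bound at a vertex with at most `Δ` edges, given the neighbouring values `t`. -/
lemma lintegral_pow_four_starFactor_le {g : ℝ} (hg : 0 < g) (a : ℝ) {β : ℝ} (hβ : 0 ≤ β) {Δ : ℕ}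
    (hΔ : 0 < Δ) : ∃ C : ℝ, 0 ≤ C ∧ ∀ (ι : Type) (S : Finset ι) (κ t : ι → ℝ) (o : ι → Bool),
      S.card ≤ Δ → 0 ≤ κ → 0 ≤ t → (∀ i, κ i ≤ β * t i) →
      ∫⁻ s in Ioi (0 : ℝ), ENNReal.ofReal (2 * g * s ^ 4 * starFactor S κ o s * quartic g a s) ≤
        ∫⁻ s in Ioi (0 : ℝ), ENNReal.ofReal
          ((C + g / Δ * ∑ i ∈ S, t i ^ 4) * starFactor S κ o s * quartic g a s) := by
  have hΔ' : (0 : ℝ) < Δ := Nat.cast_pos.2 hΔ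
  let C₀ := β ^ 2 * Δ / (8 * g)
  refine ⟨1 + Δ + Δ * C₀ + a ^ 2 / g, by positivity, fun ι S κ t o hS hκ ht hκt => ?_⟩
  obtain ⟨φ', hc, hd, hb⟩ := exists_deriv_starFactor S hκ o
  have hcφ : Continuous (starFactor S κ o) :=
    continuous_iff_continuousAt.2 fun s => (hd s).continuousAt
  have eφ := expGrowth_starFactor S hκ o
  -- The test function `s * starFactor` produces `-4 g s^4`. Of this, one `g s^4` absorbs the edge
  -- terms and another absorbs the term in `a`, leaving `-2 g s^4`. The coefficient `g / Δ` keeps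
  -- the total contribution of at most `Δ` neighbours at half of that.
  refine lintegral_quartic_le hg a (u := fun s => s * starFactor S κ o s)
    (u' := fun s => 1 * starFactor S κ o s + s * φ' s) (by fun_prop) (by simp)
    (fun s _ => (hasDerivAt_id s).mul (hd s)) (by fun_prop) (expGrowth_id.mul eφ)
    (((expGrowth_const 1).mul eφ).add
      (expGrowth_id.mul (expGrowth_deriv_starFactor S hκ o hb))) (by fun_prop)
    ((expGrowth_const _).mul eφ)
    (fun s hs => mul_nonneg (by positivity) (starFactor_nonneg S hκ o hs.le))
    (fun s hs => mul_nonneg (add_nonneg (by positivity) (mul_nonneg (by positivity)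
      (Finset.sum_nonneg fun i _ => pow_nonneg (ht i) 4))) (starFactor_nonneg S hκ o hs.le))
    fun s hs => ?_
  have n1 := starFactor_nonneg S hκ o hs.le
  obtain ⟨h1, -⟩ := hb s hs.le
  have hcard : (S.card : ℝ) ≤ Δ := Nat.cast_le.2 hS
  have quad : ∀ x : ℝ, β * x ^ 2 / 2 ≤ g / Δ * x ^ 4 + C₀ / 2 := fun x => by
    have e : g / Δ * x ^ 4 + C₀ / 2 - β * x ^ 2 / 2 = g / Δ * (x ^ 2 - β * Δ / (4 * g)) ^ 2 := by
      simp only [C₀]; field_simp; ring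
    have : 0 ≤ g / Δ * (x ^ 2 - β * Δ / (4 * g)) ^ 2 := by positivity
    linarith
  have hterm : ∀ i, s * κ i ≤ g / Δ * s ^ 4 + C₀ + g / Δ * t i ^ 4 := fun i => by
    have p1 := mul_le_mul_of_nonneg_left (hκt i) hs.le
    have p2 : s * (β * t i) ≤ β * s ^ 2 / 2 + β * t i ^ 2 / 2 := by
      nlinarith [mul_nonneg hβ (sq_nonneg (s - t i))]
    linarith [quad s, quad (t i)]
  have hsum : s * ∑ i ∈ S, κ i ≤ g * s ^ 4 + Δ * C₀ + g / Δ * ∑ i ∈ S, t i ^ 4 := by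
    rw [Finset.mul_sum]
    refine (Finset.sum_le_sum fun i _ => hterm i).trans ?_
    rw [Finset.sum_add_distrib, Finset.sum_const, nsmul_eq_mul, Finset.mul_sum]
    have p : (S.card : ℝ) * (g / Δ * s ^ 4 + C₀) ≤ Δ * (g / Δ * s ^ 4 + C₀) :=
      mul_le_mul_of_nonneg_right hcard (by positivity)
    have q : (Δ : ℝ) * (g / Δ * s ^ 4 + C₀) = g * s ^ 4 + Δ * C₀ := by field_simp
    linarith
  have ha : -(2 * a * s ^ 2) ≤ g * s ^ 4 + a ^ 2 / g := by
    have e : g * s ^ 4 + a ^ 2 / g + 2 * a * s ^ 2 = g * (s ^ 2 + a / g) ^ 2 := by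
      field_simp; ring
    have : 0 ≤ g * (s ^ 2 + a / g) ^ 2 := by positivity
    linarith
  have hfin : 1 + (S.card + s * ∑ i ∈ S, κ i) - (4 * g * s ^ 4 + 2 * a * s ^ 2) ≤
      (1 + Δ + Δ * C₀ + a ^ 2 / g + g / Δ * ∑ i ∈ S, t i ^ 4) - 2 * g * s ^ 4 := by linarith
  have := mul_le_mul_of_nonneg_right hfin n1
  linarith

/-- Bound on the weight of small values at a vertex, given the neighbouring values `t`. -/
lemma lintegral_small_starFactor_le {g : ℝ} (hg : 0 < g) (a : ℝ) {β : ℝ} (hβ : 0 ≤ β) (Δ : ℕ) :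
    ∃ C : ℝ, 0 ≤ C ∧ ∀ (ι : Type) (δ : ℝ) (S : Finset ι) (κ t : ι → ℝ) (o : ι → Bool),
      0 < δ → S.card ≤ Δ → 0 ≤ κ → 0 ≤ t → (∀ i, κ i ≤ β * t i) →
      ∫⁻ s in Ioi (0 : ℝ), ENNReal.ofReal
          (δ / (s + δ) ^ 2 * starFactor S κ o s * quartic g a s) ≤
        ∫⁻ s in Ioi (0 : ℝ), ENNReal.ofReal
          (C * (1 + s ^ 4 + ∑ i ∈ S, t i ^ 4) * starFactor S κ o s * quartic g a s) := by
  refine ⟨β * Δ + β + 4 * g + 2 * |a|, by positivity, fun ι δ S κ t o hδ hS hκ ht hκt => ?_⟩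
  obtain ⟨φ', hc, hd, hb⟩ := exists_deriv_starFactor S hκ o
  have hcφ : Continuous (starFactor S κ o) :=
    continuous_iff_continuousAt.2 fun s => (hd s).continuousAt
  have eφ := expGrowth_starFactor S hκ o
  have eφ' := expGrowth_deriv_starFactor S hκ o hb
  have hne : ∀ s ∈ Ici (0 : ℝ), s + δ ≠ 0 := fun s hs => by
    have : (0 : ℝ) ≤ s := hs
    positivity
  have e1 : ExpGrowth fun s => s / (s + δ) := (expGrowth_const 1).of_le fun s hs => by
    have : 0 ≤ s := zero_le_one.trans hs
    rw [abs_of_nonneg (by positivity), div_le_one (by positivity)]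
    linarith
  have e2 : ExpGrowth fun s => δ / (s + δ) ^ 2 := (expGrowth_const δ).of_le fun s hs => by
    have : 0 ≤ s := zero_le_one.trans hs
    rw [abs_of_nonneg (by positivity)]
    exact div_le_self hδ.le (one_le_pow₀ (by linarith))
  have c1 : ContinuousOn (fun s => s / (s + δ)) (Ici 0) :=
    continuousOn_id.div (by fun_prop) hne
  have c2 : ContinuousOn (fun s => δ / (s + δ) ^ 2) (Ici 0) :=
    continuousOn_const.div (by fun_prop) fun s hs => pow_ne_zero 2 (hne s hs)
  -- `s / (s + δ)` is a smoothed indicator of `s > δ`, bounded by 1 and vanishing at 0. Its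
  -- derivative `δ / (s + δ)^2` is of order `1 / δ` on `[0, δ]`, while every other term is bounded
  -- uniformly in `δ`.
  refine lintegral_quartic_le hg a (u := fun s => -(s / (s + δ) * starFactor S κ o s))
    (u' := fun s => -(δ / (s + δ) ^ 2 * starFactor S κ o s + s / (s + δ) * φ' s))
    (c1.mul hcφ.continuousOn).neg (by simp)
    (fun s hs => ?_) ((c2.mul hcφ.continuousOn).add (c1.mul hc.continuousOn)).neg
    (e1.mul eφ).neg ((e2.mul eφ).add (e1.mul eφ')).neg (by fun_prop)
    (((expGrowth_const _).mul (((expGrowth_const 1).add (expGrowth_pow 4)).add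
      (expGrowth_const _))).mul eφ)
    (fun s hs => mul_nonneg (by positivity) (starFactor_nonneg S hκ o hs.le))
    (fun s hs => mul_nonneg (mul_nonneg (by positivity) (add_nonneg (by positivity)
      (Finset.sum_nonneg fun i _ => pow_nonneg (ht i) 4))) (starFactor_nonneg S hκ o hs.le))
    fun s hs => ?_
  · have h1 : HasDerivAt (fun s => s / (s + δ)) (δ / (s + δ) ^ 2) s := by
      have := (hasDerivAt_id s).div ((hasDerivAt_id s).add_const δ) (hne s hs.le)
      exact this.congr_deriv (by simp)
    exact (h1.mul (hd s)).neg
  · have n1 := starFactor_nonneg S hκ o hs.le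
    obtain ⟨-, h1⟩ := hb s hs.le
    have f0 : 0 ≤ s / (s + δ) := by positivity
    have f1 : s / (s + δ) ≤ 1 := by rw [div_le_one (by positivity)]; linarith
    set f := s / (s + δ)
    have hcard : (S.card : ℝ) ≤ Δ := Nat.cast_le.2 hS
    have n2 : 0 ≤ ∑ i ∈ S, κ i := Finset.sum_nonneg fun i _ => hκ i
    have n3 : 0 ≤ ∑ i ∈ S, t i ^ 4 := Finset.sum_nonneg fun i _ => pow_nonneg (ht i) 4
    have q1 : ∀ x : ℝ, x ≤ 1 + x ^ 4 := fun x => by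
      nlinarith [sq_nonneg (x - 1), sq_nonneg (x ^ 2 - 1), sq_nonneg x]
    have q3 : s ^ 3 ≤ 1 + s ^ 4 := by
      nlinarith [sq_nonneg (s - 1), sq_nonneg (s ^ 2 - s), sq_nonneg (s ^ 2 - 1), sq_nonneg s]
    have hκs : ∑ i ∈ S, κ i ≤ β * Δ + β * ∑ i ∈ S, t i ^ 4 := by
      calc ∑ i ∈ S, κ i ≤ ∑ i ∈ S, (β + β * t i ^ 4) := Finset.sum_le_sum fun i _ =>
            (hκt i).trans (by nlinarith [mul_le_mul_of_nonneg_left (q1 (t i)) hβ])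
        _ = S.card * β + β * ∑ i ∈ S, t i ^ 4 := by
            rw [Finset.sum_add_distrib, Finset.sum_const, nsmul_eq_mul, Finset.mul_sum]
        _ ≤ _ := by nlinarith [mul_le_mul_of_nonneg_right hcard hβ]
    have m1 : -(f * φ' s) ≤ (∑ i ∈ S, κ i) * starFactor S κ o s := by
      have p1 := mul_le_mul_of_nonneg_left h1 f0
      have p2 := mul_le_mul_of_nonneg_right f1 (mul_nonneg n2 n1)
      linarith
    have m2 : f * (4 * g * s ^ 3 + 2 * a * s) ≤ (4 * g + 2 * |a|) * (1 + s ^ 4) := by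
      have r1 : 4 * g * s ^ 3 + 2 * a * s ≤ 4 * g * s ^ 3 + 2 * |a| * s := by
        nlinarith [mul_le_mul_of_nonneg_right (le_abs_self a) hs.le]
      have r2 : 0 ≤ 4 * g * s ^ 3 + 2 * |a| * s := by positivity
      have r3 : 4 * g * s ^ 3 ≤ 4 * g * (1 + s ^ 4) :=
        mul_le_mul_of_nonneg_left q3 (by positivity)
      have r4 : 2 * |a| * s ≤ 2 * |a| * (1 + s ^ 4) :=
        mul_le_mul_of_nonneg_left (q1 s) (by positivity)
      have r5 := mul_le_mul_of_nonneg_left r1 f0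
      have r6 := mul_le_mul_of_nonneg_right f1 r2
      linarith
    have m3 := mul_le_mul_of_nonneg_right m2 n1
    have hfin : (∑ i ∈ S, κ i) + (4 * g + 2 * |a|) * (1 + s ^ 4) ≤
        (β * Δ + β + 4 * g + 2 * |a|) * (1 + s ^ 4 + ∑ i ∈ S, t i ^ 4) := by
      have z1 : 0 ≤ (β * Δ + β) * s ^ 4 := by positivity
      have z2 : 0 ≤ (β * Δ + 4 * g + 2 * |a|) * ∑ i ∈ S, t i ^ 4 := by positivity
      linarith
    have m4 := mul_le_mul_of_nonneg_right hfin n1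
    linarith

end OneDim

/-! ### The single-site law on the half-line. -/

section SiteMeasure

open Set

lemma siteDensity_eq (g a t : ℝ) : siteDensity g a t = ENNReal.ofReal (quartic g a t) := rfl

lemma measurable_siteDensity (g a : ℝ) : Measurable (siteDensity g a) :=
  (continuous_quartic g a).measurable.ennreal_ofReal

lemma quartic_neg (g a t : ℝ) : quartic g a (-t) = quartic g a t := by
  simp only [quartic, even_two.neg_pow, (by decide : Even 4).neg_pow]

lemma lintegral_even {h : ℝ → ℝ≥0∞} (he : ∀ t, h (-t) = h t) :
    ∫⁻ t, h t = 2 * ∫⁻ t in Ioi 0, h t := by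
  rw [← lintegral_add_compl h (measurableSet_Ioi (a := (0 : ℝ))), compl_Ioi,
    ← setLIntegral_congr Iio_ae_eq_Iic, two_mul]
  congr 1
  have := (Measure.measurePreserving_neg (volume : Measure ℝ)).setLIntegral_comp_preimage_emb
    (MeasurableEquiv.neg ℝ).measurableEmbedding h (Ioi 0)
  rw [← this]
  simp [he]

lemma siteNorm_ne_zero (g a : ℝ) : ∫⁻ t, siteDensity g a t ≠ 0 := by
  rw [Ne, lintegral_eq_zero_iff (measurable_siteDensity g a)]
  intro h
  have h2 : (volume : Measure ℝ) univ = 0 := by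
    rw [Filter.EventuallyEq, ae_iff] at h
    refine measure_mono_null (fun t _ => ?_) h
    simp only [mem_ofPred_eq, siteDensity_eq, Pi.zero_apply, ENNReal.ofReal_eq_zero, not_le]
    exact quartic_pos g a t
  simp at h2

lemma siteNorm_ne_top {g : ℝ} (hg : 0 < g) (a : ℝ) : ∫⁻ t, siteDensity g a t ≠ ∞ := by
  rw [lintegral_even fun t => by simp only [siteDensity_eq, quartic_neg]]
  refine ENNReal.mul_ne_top (by simp) ?_
  have := (expGrowth_const 1).integrableOn continuousOn_const hg a
  simp only [one_mul] at this
  exact this.lintegral_lt_top.ne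

lemma measurable_nnabs : Measurable fun t : ℝ => Real.nnabs t := by
  simp only [← Real.toNNReal_abs]
  fun_prop

lemma isProbabilityMeasure_absSiteMeasure {g : ℝ} (hg : 0 < g) (a : ℝ) :
    IsProbabilityMeasure (absSiteMeasure g a) := by
  have : IsProbabilityMeasure (siteMeasure g a) := ⟨by
    rw [siteMeasure, Measure.smul_apply, withDensity_apply _ MeasurableSet.univ,
      Measure.restrict_univ, smul_eq_mul]
    exact ENNReal.inv_mul_cancel (siteNorm_ne_zero g a) (siteNorm_ne_top hg a)⟩
  exact Measure.isProbabilityMeasure_map measurable_nnabs.aemeasurable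

lemma lintegral_absSiteMeasure (g a : ℝ) {f : ℝ≥0 → ℝ≥0∞} (hf : Measurable f) :
    ∫⁻ u, f u ∂absSiteMeasure g a = (∫⁻ t, siteDensity g a t)⁻¹ *
      (2 * ∫⁻ s in Ioi (0 : ℝ), f s.toNNReal * ENNReal.ofReal (quartic g a s)) := by
  have hm : Measurable fun t : ℝ => f (Real.nnabs t) := hf.comp measurable_nnabs
  have he : ∀ t : ℝ, (siteDensity g a * fun t => f (Real.nnabs t)) (-t) =
      (siteDensity g a * fun t => f (Real.nnabs t)) t := fun t => by
    have : Real.nnabs (-t) = Real.nnabs t := by ext; simp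
    simp only [Pi.mul_apply, siteDensity_eq, quartic_neg, this]
  rw [absSiteMeasure, lintegral_map hf measurable_nnabs, siteMeasure, lintegral_smul_measure,
    lintegral_withDensity_eq_lintegral_mul _ (measurable_siteDensity g a) hm, smul_eq_mul,
    lintegral_even he]
  congr 2
  refine setLIntegral_congr_fun measurableSet_Ioi fun s hs => ?_
  simp only [Pi.mul_apply, siteDensity_eq]
  rw [Real.nnabs_of_nonneg (le_of_lt hs), mul_comm]

/-- The Gaussian factor only changes the parameter `a` into `a - K`; the quartic term still ensures
integrability. -/
lemma integrable_exp_sq_absSiteMeasure {g : ℝ} (hg : 0 < g) (a K : ℝ) :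
    Integrable (fun u : ℝ≥0 => Real.exp (K * u ^ 2) * (1 + (u : ℝ) ^ 4))
      (absSiteMeasure g a) := by
  have hmeas : Measurable fun u : ℝ≥0 => Real.exp (K * u ^ 2) * (1 + (u : ℝ) ^ 4) := by fun_prop
  refine ⟨hmeas.aestronglyMeasurable, ?_⟩
  rw [hasFiniteIntegral_iff_ofReal (Filter.Eventually.of_forall fun u => by positivity),
    lintegral_absSiteMeasure g a hmeas.ennreal_ofReal]
  refine ENNReal.mul_lt_top (ENNReal.inv_lt_top.2 (siteNorm_ne_zero g a).bot_lt)
    (ENNReal.mul_lt_top (by simp) ?_)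
  have := (((expGrowth_const 1).add (expGrowth_pow 4)).integrableOn (by fun_prop) hg
    (a - K)).lintegral_lt_top
  refine lt_of_le_of_lt (le_of_eq ?_) this
  refine setLIntegral_congr_fun measurableSet_Ioi fun s hs => ?_
  rw [← ENNReal.ofReal_mul (by positivity), Real.coe_toNNReal _ (le_of_lt hs)]
  congr 1
  rw [mul_right_comm, mul_comm]
  congr 1
  rw [quartic, quartic, ← Real.exp_add]
  congr 1
  ring

end SiteMeasure

/-! ### Reduction to one vertex and integrability of the weights. -/

section Moments

variable {V : Type} [Fintype V] [DecidableEq V] {G : SimpleGraph V} [DecidableRel G.Adj]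

/-- The law of independent single-site absolute values. -/
def fieldMeasure (V : Type) [Fintype V] (g a : ℝ) : Measure (V → ℝ≥0) :=
  Measure.pi fun _ : V => absSiteMeasure g a

lemma isProbabilityMeasure_fieldMeasure {g : ℝ} (hg : 0 < g) (a : ℝ) :
    IsProbabilityMeasure (fieldMeasure V g a) := by
  have := isProbabilityMeasure_absSiteMeasure hg a
  unfold fieldMeasure
  infer_instance

variable (G) in
/-- The edges at `x`. -/
def star (x : V) : Finset G.edgeSet := Finset.univ.filter fun e => x ∈ (e : Sym2 V)

/-- The endpoint of `e` other than `x` (junk value `x` if `x` is not an endpoint of `e`). -/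
def otherEnd (x : V) (e : G.edgeSet) : V :=
  if h : x ∈ (e : Sym2 V) then Sym2.Mem.other h else x

lemma star_spec {x : V} {e : G.edgeSet} (h : e ∈ star G x) :
    (e : Sym2 V) = s(x, otherEnd x e) ∧ otherEnd x e ≠ x := by
  have hx : x ∈ (e : Sym2 V) := (Finset.mem_filter.1 h).2
  have : otherEnd x e = Sym2.Mem.other hx := by rw [otherEnd, dif_pos hx]
  rw [this]
  exact ⟨(Sym2.other_spec hx).symm, Sym2.other_ne (G.not_isDiag_of_mem_edgeSet e.2) hx⟩

lemma pairProd_update_of_mem {x : V} {e : G.edgeSet} (h : e ∈ star G x) (s : V → ℝ≥0) (u : ℝ≥0) :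
    pairProd (Function.update s x u) e = s (otherEnd x e) * u := by
  obtain ⟨h1, h2⟩ := star_spec h
  rw [h1, pairProd_mk, Function.update_self, Function.update_of_ne h2, mul_comm]

lemma pairProd_update_of_notMem {x : V} {e : G.edgeSet} (h : e ∉ star G x) (s : V → ℝ≥0)
    (u : ℝ≥0) : pairProd (Function.update s x u) e = pairProd s e := by
  have hx : x ∉ (e : Sym2 V) := fun hx => h (Finset.mem_filter.2 ⟨Finset.mem_univ _, hx⟩)
  revert hx
  generalize (e : Sym2 V) = z
  induction z using Sym2.ind with
  | _ y z =>
  intro hx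
  simp only [Sym2.mem_iff, not_or] at hx
  rw [pairProd_mk, pairProd_mk, Function.update_of_ne (Ne.symm hx.1),
    Function.update_of_ne (Ne.symm hx.2)]

/-- For a fixed edge configuration the cluster count is constant, so the field at `x` enters only
through the edges at `x`. -/
lemma fkWeight_coupling_update {b : G.edgeSet → ℝ} (hb : 0 ≤ b) (ω : Config G) (s : V → ℝ≥0)
    (x : V) : ∃ K : ℝ, 0 ≤ K ∧ ∀ u : ℝ≥0, fkWeight (coupling b (Function.update s x u)) ω =
      K * starFactor (star G x) (fun e => b e * s (otherEnd x e)) ω u := by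
  refine ⟨(∏ e ∈ Finset.univ \ star G x, edgeFactor (coupling b s e) (ω e)) * 2 ^ numClusters ω,
    mul_nonneg (Finset.prod_nonneg fun e _ => edgeFactor_nonneg (coupling_nonneg hb s e) _)
      (by positivity), fun u => ?_⟩
  rw [fkWeight, ← Finset.prod_sdiff (Finset.subset_univ (star G x)), starFactor]
  rw [mul_right_comm]
  congr 1
  · congr 1
    refine Finset.prod_congr rfl fun e he => ?_
    rw [coupling, coupling, pairProd_update_of_notMem (Finset.mem_sdiff.1 he).2]
  · refine Finset.prod_congr rfl fun e he => ?_
    rw [coupling, pairProd_update_of_mem he, mul_assoc]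

/-- To compare integrals against a random cluster weight, it suffices to do so at one vertex. -/
lemma lintegral_fkWeight_le {g : ℝ} (hg : 0 < g) (a : ℝ) {b : G.edgeSet → ℝ} (hb : 0 ≤ b)
    (ω : Config G) (x : V) {P Q : (V → ℝ≥0) → ℝ} (hP : Measurable P) (hQ : Measurable Q)
    (h : ∀ s : V → ℝ≥0, ∫⁻ u in Set.Ioi (0 : ℝ), ENNReal.ofReal
          (P (Function.update s x u.toNNReal) *
            starFactor (star G x) (fun e => b e * s (otherEnd x e)) ω u * quartic g a u) ≤
        ∫⁻ u in Set.Ioi (0 : ℝ), ENNReal.ofReal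
          (Q (Function.update s x u.toNNReal) *
            starFactor (star G x) (fun e => b e * s (otherEnd x e)) ω u * quartic g a u)) :
    ∫⁻ s, ENNReal.ofReal (P s * fkWeight (coupling b s) ω) ∂fieldMeasure V g a ≤
      ∫⁻ s, ENNReal.ofReal (Q s * fkWeight (coupling b s) ω) ∂fieldMeasure V g a := by
  have := isProbabilityMeasure_absSiteMeasure hg a
  have meas : ∀ {P : (V → ℝ≥0) → ℝ}, Measurable P →
      Measurable fun s => ENNReal.ofReal (P s * fkWeight (coupling b s) ω) := fun hP =>
    (hP.mul (measurable_fkWeight b ω)).ennreal_ofReal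
  refine lintegral_le_of_lmarginal_le {x} (meas hP) (meas hQ) ?_
  rw [lmarginal_singleton, lmarginal_singleton]
  intro s
  obtain ⟨K, hK, hw⟩ := fkWeight_coupling_update hb ω s x
  have rewr : ∀ {P : (V → ℝ≥0) → ℝ}, Measurable P →
      ∫⁻ u, ENNReal.ofReal (P (Function.update s x u) *
        fkWeight (coupling b (Function.update s x u)) ω) ∂absSiteMeasure g a =
      (∫⁻ t, siteDensity g a t)⁻¹ * (2 * (ENNReal.ofReal K *
        ∫⁻ u in Set.Ioi (0 : ℝ), ENNReal.ofReal
          (P (Function.update s x u.toNNReal) *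
            starFactor (star G x) (fun e => b e * s (otherEnd x e)) ω u * quartic g a u))) := by
    intro P hP
    have hm : Measurable fun u => ENNReal.ofReal (P (Function.update s x u) *
        fkWeight (coupling b (Function.update s x u)) ω) :=
      (meas hP).comp (measurable_update s)
    rw [lintegral_absSiteMeasure g a hm,
      ← lintegral_const_mul' _ _ ENNReal.ofReal_ne_top]
    congr 2
    refine setLIntegral_congr_fun measurableSet_Ioi fun u hu => ?_
    rw [← ENNReal.ofReal_mul' (quartic_pos g a u).le, ← ENNReal.ofReal_mul hK, hw,
      Real.coe_toNNReal _ (le_of_lt hu)]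
    congr 1
    ring
  simp only [rewr hP, rewr hQ]
  exact mul_le_mul_right (mul_le_mul_right (mul_le_mul_right (h s) _) _) _

lemma integrable_prod_exp_sq {g : ℝ} (hg : 0 < g) (a K : ℝ) :
    Integrable (fun s : V → ℝ≥0 => ∏ x, (Real.exp (K * s x ^ 2) * (1 + (s x : ℝ) ^ 4)))
      (fieldMeasure V g a) := by
  have := isProbabilityMeasure_absSiteMeasure hg a
  exact Integrable.fintype_prod fun _ => integrable_exp_sq_absSiteMeasure hg a K

lemma pairProd_le_sum_sq (s : V → ℝ≥0) (e : Sym2 V) : pairProd s e ≤ ∑ x, (s x : ℝ) ^ 2 := by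
  induction e using Sym2.ind with
  | _ x y =>
  have h : ∀ z, (s z : ℝ) ^ 2 ≤ ∑ x, (s x : ℝ) ^ 2 := fun z =>
    Finset.single_le_sum (f := fun x => (s x : ℝ) ^ 2) (fun _ _ => sq_nonneg _)
      (Finset.mem_univ z)
  rw [pairProd_mk]
  nlinarith [h x, h y, sq_nonneg ((s x : ℝ) - s y)]

lemma fkWeight_coupling_le {b : G.edgeSet → ℝ} (hb : 0 ≤ b) (ω : Config G) (s : V → ℝ≥0) :
    fkWeight (coupling b s) ω ≤ (2 ^ Fintype.card G.edgeSet * 2 ^ numClusters ω) *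
      ∏ x, Real.exp ((∑ e, b e) * s x ^ 2) := by
  rw [fkWeight, mul_right_comm]
  refine mul_le_mul_of_nonneg_right ?_ (by positivity)
  calc ∏ e, edgeFactor (coupling b s e) (ω e) ≤ ∏ e, 2 * Real.exp (coupling b s e) :=
        Finset.prod_le_prod (fun e _ => edgeFactor_nonneg (coupling_nonneg hb s e) _)
          fun e _ => edgeFactor_le (coupling_nonneg hb s e) _
    _ = 2 ^ Fintype.card G.edgeSet * Real.exp (∑ e, coupling b s e) := by
        rw [Finset.prod_mul_distrib, Finset.prod_const, Real.exp_sum]; rfl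
    _ ≤ 2 ^ Fintype.card G.edgeSet * Real.exp (∑ x, (∑ e, b e) * (s x : ℝ) ^ 2) := by
        refine mul_le_mul_of_nonneg_left (Real.exp_le_exp.2 ?_) (by positivity)
        rw [← Finset.mul_sum, Finset.sum_mul]
        exact Finset.sum_le_sum fun e _ =>
          mul_le_mul_of_nonneg_left (pairProd_le_sum_sq s e) (hb e)
    _ = _ := by rw [Real.exp_sum]

lemma integrable_mul_fkWeight {g : ℝ} (hg : 0 < g) (a : ℝ) {b : G.edgeSet → ℝ} (hb : 0 ≤ b)
    (ω : Config G) {P : (V → ℝ≥0) → ℝ} (hP : Measurable P)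
    (hP1 : ∀ s, |P s| ≤ ∏ x, (1 + (s x : ℝ) ^ 4)) :
    Integrable (fun s => P s * fkWeight (coupling b s) ω) (fieldMeasure V g a) := by
  refine ((integrable_prod_exp_sq hg a (∑ e, b e)).const_mul
    (2 ^ Fintype.card G.edgeSet * 2 ^ numClusters ω)).mono'
    (hP.mul (measurable_fkWeight b ω)).aestronglyMeasurable
    (Filter.Eventually.of_forall fun s => ?_)
  rw [Real.norm_eq_abs, abs_mul, abs_of_nonneg (fkWeight_nonneg (coupling_nonneg hb s) ω),
    Finset.prod_mul_distrib, ← mul_assoc, mul_comm]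
  exact mul_le_mul (fkWeight_coupling_le hb ω s) (hP1 s) (abs_nonneg _)
    (mul_nonneg (by positivity) (Finset.prod_nonneg fun _ _ => (Real.exp_pos _).le))

lemma one_le_prod_one_add_pow (S : Finset V) (s : V → ℝ≥0) :
    1 ≤ ∏ x ∈ S, (1 + (s x : ℝ) ^ 4) := by
  calc (1 : ℝ) = ∏ _x ∈ S, 1 := by simp
    _ ≤ _ := Finset.prod_le_prod (fun _ _ => zero_le_one) fun x _ =>
      le_add_of_nonneg_right (by positivity)

lemma integrable_bdd_mul_fkWeight {g : ℝ} (hg : 0 < g) (a : ℝ) {b : G.edgeSet → ℝ} (hb : 0 ≤ b)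
    (ω : Config G) {P : (V → ℝ≥0) → ℝ} (hP : Measurable P) (hP1 : ∀ s, |P s| ≤ 1) :
    Integrable (fun s => P s * fkWeight (coupling b s) ω) (fieldMeasure V g a) :=
  integrable_mul_fkWeight hg a hb ω hP fun s => (hP1 s).trans (one_le_prod_one_add_pow _ s)

lemma integrable_fkWeight {g : ℝ} (hg : 0 < g) (a : ℝ) {b : G.edgeSet → ℝ} (hb : 0 ≤ b)
    (ω : Config G) :
    Integrable (fun s => fkWeight (coupling b s) ω) (fieldMeasure V g a) := by
  simpa using integrable_bdd_mul_fkWeight hg a hb ω (P := fun _ => 1) measurable_const (by simp)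

lemma integrable_pow_four_mul_fkWeight {g : ℝ} (hg : 0 < g) (a : ℝ) {b : G.edgeSet → ℝ}
    (hb : 0 ≤ b) (ω : Config G) (x : V) :
    Integrable (fun s => (s x : ℝ) ^ 4 * fkWeight (coupling b s) ω) (fieldMeasure V g a) := by
  refine integrable_mul_fkWeight hg a hb ω (by fun_prop) fun s => ?_
  rw [abs_of_nonneg (by positivity)]
  calc (s x : ℝ) ^ 4 ≤ 1 + (s x : ℝ) ^ 4 := by linarith
    _ ≤ ∏ x, (1 + (s x : ℝ) ^ 4) := by
      rw [← Finset.mul_prod_erase _ _ (Finset.mem_univ x)]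
      exact le_mul_of_one_le_right (by positivity) (one_le_prod_one_add_pow _ s)

end Moments

/-! ### Bounds on the field given the edges, uniform in the graph. -/

section UniformBounds

variable {V : Type} [Fintype V] [DecidableEq V] {G : SimpleGraph V} [DecidableRel G.Adj]

lemma integral_le_of_lintegral_ofReal_le {α : Type*} [MeasurableSpace α] {μ : Measure α}
    {f h : α → ℝ} (hf : Integrable f μ) (hh : Integrable h μ) (hf0 : ∀ x, 0 ≤ f x)
    (hh0 : ∀ x, 0 ≤ h x)
    (hle : ∫⁻ x, ENNReal.ofReal (f x) ∂μ ≤ ∫⁻ x, ENNReal.ofReal (h x) ∂μ) :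
    ∫ x, f x ∂μ ≤ ∫ x, h x ∂μ := by
  rw [← ofReal_integral_eq_lintegral_ofReal hf (Filter.Eventually.of_forall hf0),
    ← ofReal_integral_eq_lintegral_ofReal hh (Filter.Eventually.of_forall hh0)] at hle
  exact (ENNReal.ofReal_le_ofReal_iff (integral_nonneg hh0)).1 hle

/-- The total mass of a random cluster weight. -/
def totalMass (g a : ℝ) (b : G.edgeSet → ℝ) (ω : Config G) : ℝ :=
  ∫ s, fkWeight (coupling b s) ω ∂fieldMeasure V g a

/-- The (unnormalised) fourth moment of the field at `x` given the edge configuration. -/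
def fourthMoment (g a : ℝ) (b : G.edgeSet → ℝ) (ω : Config G) (x : V) : ℝ :=
  ∫ s, (s x : ℝ) ^ 4 * fkWeight (coupling b s) ω ∂fieldMeasure V g a

lemma totalMass_nonneg (g a : ℝ) {b : G.edgeSet → ℝ} (hb : 0 ≤ b) (ω : Config G) :
    0 ≤ totalMass g a b ω :=
  integral_nonneg fun s => fkWeight_nonneg (coupling_nonneg hb s) ω

lemma fourthMoment_nonneg (g a : ℝ) {b : G.edgeSet → ℝ} (hb : 0 ≤ b) (ω : Config G) (x : V) :
    0 ≤ fourthMoment g a b ω x :=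
  integral_nonneg fun s => mul_nonneg (by positivity) (fkWeight_nonneg (coupling_nonneg hb s) ω)

lemma integral_affine_mul_fkWeight {g : ℝ} (hg : 0 < g) (a : ℝ) {b : G.edgeSet → ℝ} (hb : 0 ≤ b)
    (ω : Config G) (S : Finset G.edgeSet) (f : G.edgeSet → V) (c c' : ℝ) :
    Integrable (fun s => (c + c' * ∑ e ∈ S, (s (f e) : ℝ) ^ 4) * fkWeight (coupling b s) ω)
        (fieldMeasure V g a) ∧
      ∫ s, (c + c' * ∑ e ∈ S, (s (f e) : ℝ) ^ 4) * fkWeight (coupling b s) ω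
        ∂fieldMeasure V g a =
      c * totalMass g a b ω + c' * ∑ e ∈ S, fourthMoment g a b ω (f e) := by
  have i1 := (integrable_fkWeight hg a hb ω).const_mul c
  have i3 : ∀ e ∈ S, Integrable (fun s => (s (f e) : ℝ) ^ 4 * fkWeight (coupling b s) ω)
      (fieldMeasure V g a) := fun e _ => integrable_pow_four_mul_fkWeight hg a hb ω (f e)
  have i2 := (integrable_finsetSum S i3).const_mul c'
  have heq : (fun s => (c + c' * ∑ e ∈ S, (s (f e) : ℝ) ^ 4) * fkWeight (coupling b s) ω) =
      fun s => c * fkWeight (coupling b s) ω +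
        c' * ∑ e ∈ S, (s (f e) : ℝ) ^ 4 * fkWeight (coupling b s) ω := by
    funext s
    rw [add_mul, mul_assoc c', Finset.sum_mul]
  rw [heq]
  refine ⟨i1.add i2, ?_⟩
  rw [integral_add i1 i2, integral_const_mul, integral_const_mul, integral_finsetSum S i3]
  rfl

lemma sum_star_update (s : V → ℝ≥0) (x : V) (u : ℝ≥0) :
    ∑ e ∈ star G x, (Function.update s x u (otherEnd x e) : ℝ) ^ 4 =
      ∑ e ∈ star G x, (s (otherEnd x e) : ℝ) ^ 4 :=
  Finset.sum_congr rfl fun e he => by rw [Function.update_of_ne (star_spec he).2]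

/-- Fourth moments given the edge configuration are bounded, uniformly in the graph, the
couplings and the configuration. -/
lemma exists_fourthMoment_le {g : ℝ} (hg : 0 < g) (a : ℝ) {β : ℝ} (hβ : 0 ≤ β) {Δ : ℕ}
    (hΔ : 0 < Δ) : ∃ C : ℝ, 0 ≤ C ∧ ∀ (V : Type) [Fintype V] [DecidableEq V] (G : SimpleGraph V)
      [DecidableRel G.Adj] (b : G.edgeSet → ℝ) (ω : Config G) (x : V),
      (∀ x, (star G x).card ≤ Δ) → 0 ≤ b → (∀ e, b e ≤ β) →
      fourthMoment g a b ω x ≤ C * totalMass g a b ω := by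
  obtain ⟨C, hC, h⟩ := lintegral_pow_four_starFactor_le hg a hβ hΔ
  refine ⟨C / g, by positivity, fun V _ _ G _ b ω x₀ hdeg hb hbβ => ?_⟩
  have hΔ' : (0 : ℝ) < Δ := Nat.cast_pos.2 hΔ
  have step : ∀ x, 2 * g * fourthMoment g a b ω x ≤ C * totalMass g a b ω +
      g / Δ * ∑ e ∈ star G x, fourthMoment g a b ω (otherEnd x e) := by
    intro x
    have key := lintegral_fkWeight_le hg a hb ω x (P := fun s => 2 * g * (s x : ℝ) ^ 4)
      (Q := fun s => C + g / Δ * ∑ e ∈ star G x, (s (otherEnd x e) : ℝ) ^ 4) (by fun_prop)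
      (by fun_prop) fun s => by
        simp only [Function.update_self, sum_star_update]
        refine le_trans (le_of_eq ?_) (h G.edgeSet (star G x)
          (fun e => b e * s (otherEnd x e)) (fun e => s (otherEnd x e)) ω (hdeg x)
          (fun e => mul_nonneg (hb e) (NNReal.coe_nonneg _)) (fun e => NNReal.coe_nonneg _)
          fun e => mul_le_mul_of_nonneg_right (hbβ e) (NNReal.coe_nonneg _))
        refine setLIntegral_congr_fun measurableSet_Ioi fun u hu => ?_
        rw [Real.coe_toNNReal _ (le_of_lt hu)]
    obtain ⟨iQ, eQ⟩ := integral_affine_mul_fkWeight hg a hb ω (star G x) (otherEnd x) C (g / Δ)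
    have iP : Integrable (fun s => 2 * g * (s x : ℝ) ^ 4 * fkWeight (coupling b s) ω)
        (fieldMeasure V g a) := by
      simpa only [mul_assoc] using
        ((integrable_pow_four_mul_fkWeight hg a hb ω x).const_mul g).const_mul 2
    have := integral_le_of_lintegral_ofReal_le iP iQ
      (fun s => mul_nonneg (by positivity) (fkWeight_nonneg (coupling_nonneg hb s) ω))
      (fun s => mul_nonneg (by positivity) (fkWeight_nonneg (coupling_nonneg hb s) ω)) key
    rw [eQ] at this
    refine le_trans (le_of_eq ?_) this
    rw [fourthMoment, ← integral_const_mul]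
    simp only [mul_assoc]
  have : Nonempty V := ⟨x₀⟩
  -- Maximum principle: at a vertex with the largest fourth moment, the neighbours contribute at
  -- most `g` times that moment, half of the left-hand side of `step`. Integrability makes the
  -- subtraction legitimate.
  obtain ⟨y, hy⟩ := Finite.exists_max (fourthMoment g a b ω)
  have hsum : g / Δ * ∑ e ∈ star G y, fourthMoment g a b ω (otherEnd y e) ≤
      g * fourthMoment g a b ω y := by
    have h0 := fourthMoment_nonneg g a hb ω y
    have h1 : ∑ e ∈ star G y, fourthMoment g a b ω (otherEnd y e) ≤
        Δ * fourthMoment g a b ω y := by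
      refine (Finset.sum_le_card_nsmul _ _ _ fun e _ => hy _).trans ?_
      rw [nsmul_eq_mul]
      exact mul_le_mul_of_nonneg_right (Nat.cast_le.2 (hdeg y)) h0
    refine (mul_le_mul_of_nonneg_left h1 (by positivity)).trans (le_of_eq ?_)
    field_simp
  refine (hy x₀).trans ?_
  rw [div_mul_eq_mul_div, le_div_iff₀ hg]
  linarith [step y]

lemma tanh_mono {x y : ℝ} (h : x ≤ y) : Real.tanh x ≤ Real.tanh y := by
  rw [Real.tanh_eq_sinh_div_cosh, Real.tanh_eq_sinh_div_cosh,
    div_le_div_iff₀ (Real.cosh_pos x) (Real.cosh_pos y)]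
  have := Real.sinh_nonneg_iff.2 (sub_nonneg.2 h)
  rw [Real.sinh_sub] at this
  linarith

@[fun_prop]
lemma measurable_tanh : Measurable Real.tanh := by
  have : Real.tanh = fun x => Real.sinh x / Real.cosh x := by
    funext x; exact Real.tanh_eq_sinh_div_cosh x
  rw [this]
  fun_prop

/-- The field at a vertex is rarely small given the edge configuration. -/
lemma exists_small_le {g : ℝ} (hg : 0 < g) (a : ℝ) {β : ℝ} (hβ : 0 ≤ β) {Δ : ℕ}
    (hΔ : 0 < Δ) : ∃ C : ℝ, 0 ≤ C ∧ ∀ (V : Type) [Fintype V] [DecidableEq V] (G : SimpleGraph V)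
      [DecidableRel G.Adj] (b : G.edgeSet → ℝ) (ω : Config G) (x : V) (δ : ℝ),
      (∀ x, (star G x).card ≤ Δ) → 0 ≤ b → (∀ e, b e ≤ β) → 0 < δ →
      Integrable (fun s => δ / (s x + δ) ^ 2 * fkWeight (coupling b s) ω) (fieldMeasure V g a) ∧
      ∫ s, δ / (s x + δ) ^ 2 * fkWeight (coupling b s) ω ∂fieldMeasure V g a ≤
        C * totalMass g a b ω := by
  obtain ⟨C, hC, h⟩ := lintegral_small_starFactor_le hg a hβ Δ
  obtain ⟨M, hM, hmom⟩ := exists_fourthMoment_le hg a hβ hΔ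
  refine ⟨C * (1 + M + Δ * M), by positivity, fun V _ _ G _ b ω x δ hdeg hb hbβ hδ => ?_⟩
  have hmom' := fun y => hmom V G b ω y hdeg hb hbβ
  have hN := totalMass_nonneg g a hb ω
  have iP : Integrable (fun s => δ / (s x + δ) ^ 2 * fkWeight (coupling b s) ω)
      (fieldMeasure V g a) := by
    have := (integrable_bdd_mul_fkWeight hg a hb ω (P := fun s => δ ^ 2 / (s x + δ) ^ 2)
      (by fun_prop) fun s => by
        have : (0 : ℝ) ≤ s x := NNReal.coe_nonneg _
        rw [abs_of_nonneg (by positivity), div_le_one (by positivity)]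
        exact pow_le_pow_left₀ hδ.le (by linarith) 2).const_mul δ⁻¹
    refine this.congr (Filter.Eventually.of_forall fun s => ?_)
    simp only
    field_simp
  refine ⟨iP, ?_⟩
  have key := lintegral_fkWeight_le hg a hb ω x (P := fun s => δ / (s x + δ) ^ 2)
    (Q := fun s => C * (1 + (s x : ℝ) ^ 4 + ∑ e ∈ star G x, (s (otherEnd x e) : ℝ) ^ 4))
    (by fun_prop) (by fun_prop) fun s => by
      simp only [Function.update_self, sum_star_update]
      refine le_trans (le_of_eq ?_) ((h G.edgeSet δ (star G x)
        (fun e => b e * s (otherEnd x e)) (fun e => s (otherEnd x e)) ω hδ (hdeg x)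
        (fun e => mul_nonneg (hb e) (NNReal.coe_nonneg _)) (fun e => NNReal.coe_nonneg _)
        fun e => mul_le_mul_of_nonneg_right (hbβ e) (NNReal.coe_nonneg _)).trans (le_of_eq ?_))
      · refine setLIntegral_congr_fun measurableSet_Ioi fun u hu => ?_
        rw [Real.coe_toNNReal _ (le_of_lt hu)]
      · refine setLIntegral_congr_fun measurableSet_Ioi fun u hu => ?_
        rw [Real.coe_toNNReal _ (le_of_lt hu)]
  obtain ⟨i1, e1⟩ := integral_affine_mul_fkWeight hg a hb ω (star G x) (otherEnd x) C C
  have i2 := (integrable_pow_four_mul_fkWeight hg a hb ω x).const_mul C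
  have hQ : (fun s : V → ℝ≥0 => C * (1 + (s x : ℝ) ^ 4 +
      ∑ e ∈ star G x, (s (otherEnd x e) : ℝ) ^ 4) * fkWeight (coupling b s) ω) = fun s =>
      (C + C * ∑ e ∈ star G x, (s (otherEnd x e) : ℝ) ^ 4) * fkWeight (coupling b s) ω +
        C * ((s x : ℝ) ^ 4 * fkWeight (coupling b s) ω) := by
    funext s; ring
  have hle := integral_le_of_lintegral_ofReal_le iP (by rw [hQ]; exact i1.add i2)
    (fun s => mul_nonneg (by positivity) (fkWeight_nonneg (coupling_nonneg hb s) ω))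
    (fun s => mul_nonneg (by positivity) (fkWeight_nonneg (coupling_nonneg hb s) ω)) key
  refine hle.trans ?_
  rw [hQ, integral_add i1 i2, e1, integral_const_mul]
  have hsum : ∑ e ∈ star G x, fourthMoment g a b ω (otherEnd x e) ≤
      Δ * (M * totalMass g a b ω) := by
    refine (Finset.sum_le_card_nsmul _ _ _ fun e _ => hmom' _).trans ?_
    rw [nsmul_eq_mul]
    exact mul_le_mul_of_nonneg_right (Nat.cast_le.2 (hdeg x)) (mul_nonneg hM hN)
  have e3 : ∫ s, (s x : ℝ) ^ 4 * fkWeight (coupling b s) ω ∂fieldMeasure V g a =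
    fourthMoment g a b ω x := rfl
  rw [e3]
  have r1 := mul_le_mul_of_nonneg_left hsum hC
  have r2 := mul_le_mul_of_nonneg_left (hmom' x) hC
  linarith

/-- The sprinkling probability that can be gained at an edge is bounded below, uniformly in the
graph, the couplings and the edge configuration. -/
lemma exists_le_integral_tanh {g : ℝ} (hg : 0 < g) (a : ℝ) {β : ℝ} (hβ : 0 ≤ β) {Δ : ℕ}
    (hΔ : 0 < Δ) {c : ℝ} (hc : 0 < c) : ∃ ε : ℝ, 0 < ε ∧ ε ≤ 1 ∧ ∀ (V : Type) [Fintype V]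
      [DecidableEq V] (G : SimpleGraph V) [DecidableRel G.Adj] (b : G.edgeSet → ℝ)
      (ω : Config G) (e : G.edgeSet),
      (∀ x, (star G x).card ≤ Δ) → 0 ≤ b → (∀ e, b e ≤ β) →
      ε * totalMass g a b ω ≤ ∫ s, Real.tanh (c * pairProd s e) * fkWeight (coupling b s) ω
        ∂fieldMeasure V g a := by
  obtain ⟨C, hC, h⟩ := exists_small_le hg a hβ hΔ
  -- With this `δ`, each endpoint has conditional probability at most `4 δ C ≤ 1/4` of lying below
  -- `δ`. Both are at least `δ` with probability at least 1/2, whence `ε = tanh (c δ^2) / 2`.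
  let δ := 1 / (16 * (C + 1))
  have hδ : 0 < δ := by positivity
  have hτ : 0 < Real.tanh (c * δ ^ 2) := by
    rw [Real.tanh_eq_sinh_div_cosh]
    exact div_pos (Real.sinh_pos_iff.2 (by positivity)) (Real.cosh_pos _)
  have hτ1 := tanh_le_one (c * δ ^ 2)
  refine ⟨Real.tanh (c * δ ^ 2) / 2, by positivity, by linarith,
    fun V _ _ G _ b ω e hdeg hb hbβ => ?_⟩
  have hN := totalMass_nonneg g a hb ω
  have iT : Integrable (fun s => Real.tanh (c * pairProd s e) * fkWeight (coupling b s) ω)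
      (fieldMeasure V g a) := integrable_bdd_mul_fkWeight hg a hb ω (by fun_prop) fun s => by
    rw [abs_of_nonneg (tanh_nonneg (mul_nonneg hc.le (pairProd_nonneg s e)))]
    exact tanh_le_one _
  obtain ⟨x, y, hxy⟩ : ∃ x y, (e : Sym2 V) = s(x, y) := by
    generalize (e : Sym2 V) = z
    induction z using Sym2.ind with
    | _ x y => exact ⟨x, y, rfl⟩
  obtain ⟨ix, hx⟩ := h V G b ω x δ hdeg hb hbβ hδ
  obtain ⟨iy, hy⟩ := h V G b ω y δ hdeg hb hbβ hδ
  set τ := Real.tanh (c * δ ^ 2)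
  have iw := integrable_fkWeight hg a hb ω
  have hsmall : ∀ u : ℝ, 0 ≤ u → u < δ → 1 ≤ 4 * δ * (δ / (u + δ) ^ 2) := fun u hu hu' => by
    rw [mul_div_assoc', le_div_iff₀ (by positivity), one_mul]
    nlinarith
  -- The indicator that both endpoints are at least `δ` is bounded below by 1 minus the two
  -- majorants from `hsmall`.
  have hpt : ∀ s : V → ℝ≥0, τ * (fkWeight (coupling b s) ω -
        4 * δ * (δ / (s x + δ) ^ 2 * fkWeight (coupling b s) ω) -
        4 * δ * (δ / (s y + δ) ^ 2 * fkWeight (coupling b s) ω)) ≤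
      Real.tanh (c * pairProd s e) * fkWeight (coupling b s) ω := by
    intro s
    have w0 := fkWeight_nonneg (coupling_nonneg hb s) ω
    have sx : (0 : ℝ) ≤ s x := NNReal.coe_nonneg _
    have sy : (0 : ℝ) ≤ s y := NNReal.coe_nonneg _
    have px : 0 ≤ 4 * δ * (δ / (s x + δ) ^ 2) := by positivity
    have py : 0 ≤ 4 * δ * (δ / (s y + δ) ^ 2) := by positivity
    have t0 := tanh_nonneg (mul_nonneg hc.le (pairProd_nonneg s e))
    have hb : τ * (1 - 4 * δ * (δ / (s x + δ) ^ 2) - 4 * δ * (δ / (s y + δ) ^ 2)) ≤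
        Real.tanh (c * pairProd s e) := by
      rcases lt_or_ge (s x : ℝ) δ with hx | hx
      · have := hsmall _ sx hx
        exact (mul_nonpos_of_nonneg_of_nonpos hτ.le (by linarith)).trans t0
      rcases lt_or_ge (s y : ℝ) δ with hy | hy
      · have := hsmall _ sy hy
        exact (mul_nonpos_of_nonneg_of_nonpos hτ.le (by linarith)).trans t0
      refine (mul_le_of_le_one_right hτ.le (by linarith)).trans (tanh_mono ?_)
      rw [hxy, pairProd_mk]
      refine mul_le_mul_of_nonneg_left ?_ hc.le
      nlinarith
    have := mul_le_mul_of_nonneg_right hb w0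
    linarith
  have hint := integral_mono (((iw.sub (ix.const_mul (4 * δ))).sub
    (iy.const_mul (4 * δ))).const_mul τ) iT hpt
  refine le_trans ?_ hint
  rw [integral_const_mul, integral_sub' (iw.sub (ix.const_mul (4 * δ))) (iy.const_mul (4 * δ)),
    integral_sub' iw (ix.const_mul (4 * δ)), integral_const_mul, integral_const_mul]
  change _ ≤ τ * (totalMass g a b ω - _ - _)
  have q : 4 * δ * (C * totalMass g a b ω) ≤ totalMass g a b ω / 4 := by
    have : 4 * δ * C ≤ 1 / 4 := by
      simp only [δ]
      rw [mul_one_div, div_mul_eq_mul_div, div_le_div_iff₀ (by positivity) (by positivity)]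
      linarith
    nlinarith
  have qx := mul_le_mul_of_nonneg_left hx (show 0 ≤ 4 * δ by positivity)
  have qy := mul_le_mul_of_nonneg_left hy (show 0 ≤ 4 * δ by positivity)
  rw [div_mul_eq_mul_div, mul_div_assoc]
  exact mul_le_mul_of_nonneg_left (by linarith) hτ.le

end UniformBounds

/-! ### Sprinkling one edge, then all edges. -/

section Domination

variable {V : Type} [Fintype V] [DecidableEq V] {G : SimpleGraph V} [DecidableRel G.Adj]

lemma totalMass_bot_pos {g : ℝ} (hg : 0 < g) (a : ℝ) {b : G.edgeSet → ℝ} (hb : 0 ≤ b) :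
    0 < totalMass g a b ⊥ := by
  have := isProbabilityMeasure_fieldMeasure (V := V) hg a
  rw [totalMass, integral_pos_iff_support_of_nonneg
    (fun s => fkWeight_nonneg (coupling_nonneg hb s) _) (integrable_fkWeight hg a hb _)]
  have : Function.support (fun s => fkWeight (coupling b s) (⊥ : Config G)) = Set.univ :=
    Set.eq_univ_of_forall fun s => (fkWeight_bot_pos _).ne'
  rw [this]
  simp

lemma sum_totalMass_pos {g : ℝ} (hg : 0 < g) (a : ℝ) {b : G.edgeSet → ℝ} (hb : 0 ≤ b) :
    0 < ∑ ω, totalMass g a b ω :=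
  Finset.sum_pos' (fun ω _ => totalMass_nonneg g a hb ω)
    ⟨⊥, Finset.mem_univ _, totalMass_bot_pos hg a hb⟩

/-- Expectations under the edge marginal with couplings `b`. -/
def rcExp (g a : ℝ) (b : G.edgeSet → ℝ) (F : Config G → ℝ) : ℝ :=
  (∑ ω, totalMass g a b ω * F ω) / ∑ ω, totalMass g a b ω

lemma integrable_sum_fkWeight {g : ℝ} (hg : 0 < g) (a : ℝ) {b : G.edgeSet → ℝ} (hb : 0 ≤ b)
    (F : Config G → ℝ) : Integrable (fun s => ∑ ω, fkWeight (coupling b s) ω * F ω)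
      (fieldMeasure V g a) :=
  integrable_finsetSum _ fun ω _ => (integrable_fkWeight hg a hb ω).mul_const _

lemma integral_sum_fkWeight {g : ℝ} (hg : 0 < g) (a : ℝ) {b : G.edgeSet → ℝ} (hb : 0 ≤ b)
    (F : Config G → ℝ) : ∫ s, ∑ ω, fkWeight (coupling b s) ω * F ω ∂fieldMeasure V g a =
      ∑ ω, totalMass g a b ω * F ω := by
  rw [integral_finsetSum _ fun ω _ => (integrable_fkWeight hg a hb ω).mul_const _]
  exact Finset.sum_congr rfl fun ω _ => integral_mul_const _ _

lemma lintegral_sum_fkWeight {g : ℝ} (hg : 0 < g) (a : ℝ) {b : G.edgeSet → ℝ} (hb : 0 ≤ b)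
    {F : Config G → ℝ} (hF : 0 ≤ F) :
    ∫⁻ s, ENNReal.ofReal (∑ ω, fkWeight (coupling b s) ω * F ω) ∂fieldMeasure V g a =
      ENNReal.ofReal (∑ ω, totalMass g a b ω * F ω) := by
  rw [← integral_sum_fkWeight hg a hb F, ofReal_integral_eq_lintegral_ofReal
    (integrable_sum_fkWeight hg a hb F) (Filter.Eventually.of_forall fun s =>
      Finset.sum_nonneg fun ω _ => mul_nonneg (fkWeight_nonneg (coupling_nonneg hb s) ω) (hF ω))]

lemma coupling_update (b : G.edgeSet → ℝ) (e : G.edgeSet) (c : ℝ) (s : V → ℝ≥0) :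
    coupling (Function.update b e (b e + c)) s =
      Function.update (coupling b s) e (coupling b s e + c * pairProd s e) := by
  funext i
  by_cases hi : i = e
  · subst hi; simp [coupling, add_mul]
  · simp [coupling, Function.update_of_ne hi]

/-- Raising one coupling dominates sprinkling the corresponding edge. -/
lemma rcExp_sprinkle_le {g : ℝ} (hg : 0 < g) (a : ℝ) {b : G.edgeSet → ℝ} (hb : 0 ≤ b)
    (e : G.edgeSet) {c ε : ℝ} (hc : 0 ≤ c)
    (hε : ∀ ω, ε * totalMass g a b ω ≤
      ∫ s, Real.tanh (c * pairProd s e) * fkWeight (coupling b s) ω ∂fieldMeasure V g a)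
    {F : Config G → ℝ} (hF : Monotone F) (hF0 : 0 ≤ F) :
    rcExp g a b (fun ω => F ω + ε * (F (Function.update ω e true) - F ω)) ≤
      rcExp g a (Function.update b e (b e + c)) F := by
  have := isProbabilityMeasure_absSiteMeasure hg a
  set b' := Function.update b e (b e + c) with hb'_def
  have hbb : b ≤ b' := le_update_iff.2 ⟨by linarith, fun _ _ => le_rfl⟩
  have hb' : 0 ≤ b' := hb.trans hbb
  rw [rcExp, rcExp, div_le_div_iff₀ (sum_totalMass_pos hg a hb) (sum_totalMass_pos hg a hb'),
    mul_comm (∑ ω, totalMass g a b' ω * F ω)]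
  -- `H` is the expectation of `F` under `b'` for a frozen field. The raised expectation is the mean
  -- of `H` for the field under `b'`; `four` bounds it below by the mean of `H` for the field under
  -- `b`.
  let H : (V → ℝ≥0) → ℝ := fun s =>
    (∑ ω, fkWeight (coupling b' s) ω * F ω) / fkZ (coupling b' s)
  have hH : Monotone H := fk_coupling_mono hb' hF hF0
  have hN0 : ∀ s, 0 ≤ ∑ ω, fkWeight (coupling b' s) ω * F ω := fun s =>
    Finset.sum_nonneg fun ω _ => mul_nonneg (fkWeight_nonneg (coupling_nonneg hb' s) ω) (hF0 ω)
  have hZ : ∀ {b : G.edgeSet → ℝ}, 0 ≤ b → ∀ s, 0 < fkZ (coupling b s) := fun hb s =>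
    fkZ_pos (coupling_nonneg hb s)
  have hH0 : ∀ s, 0 ≤ H s := fun s => div_nonneg (hN0 s) (hZ hb' s).le
  have hHZ : ∀ s, fkZ (coupling b' s) * H s = ∑ ω, fkWeight (coupling b' s) ω * F ω := fun s =>
    mul_div_cancel₀ _ (hZ hb' s).ne'
  have mN : Measurable fun s => ∑ ω, fkWeight (coupling b' s) ω * F ω :=
    Finset.measurable_sum _ fun ω _ => (measurable_fkWeight b' ω).mul_const _
  have mH : Measurable H := mN.div (measurable_fkZ b')
  have four := lintegral_four_functions (fun _ : V => absSiteMeasure g a)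
    (f₁ := fun s => ENNReal.ofReal (fkZ (coupling b s) * H s))
    (f₂ := fun s => ENNReal.ofReal (fkZ (coupling b' s)))
    (f₃ := fun s => ENNReal.ofReal (fkZ (coupling b s)))
    (f₄ := fun s => ENNReal.ofReal (∑ ω, fkWeight (coupling b' s) ω * F ω))
    ((measurable_fkZ b).mul mH).ennreal_ofReal (measurable_fkZ b').ennreal_ofReal
    (measurable_fkZ b).ennreal_ofReal mN.ennreal_ofReal fun s t => by
      rw [← ENNReal.ofReal_mul (mul_nonneg (hZ hb s).le (hH0 s)),
        ← ENNReal.ofReal_mul (hZ hb _).le, ← hHZ]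
      refine ENNReal.ofReal_le_ofReal ?_
      have h1 := mul_le_mul (fkZ_coupling_four hb hbb s t) (hH (le_sup_left : s ≤ s ⊔ t)) (hH0 s)
        (mul_nonneg (hZ hb _).le (hZ hb' _).le)
      linarith
  let T : (V → ℝ≥0) → ℝ := fun s => Real.tanh (c * pairProd s e)
  have hT0 : ∀ s, 0 ≤ T s := fun s => tanh_nonneg (mul_nonneg hc (pairProd_nonneg s e))
  have iT : ∀ ω, Integrable (fun s => T s * fkWeight (coupling b s) ω) (fieldMeasure V g a) :=
    fun ω => integrable_bdd_mul_fkWeight hg a hb ω (by fun_prop) fun s => by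
      rw [abs_of_nonneg (hT0 s)]
      exact tanh_le_one _
  have hle : ∀ ω, 0 ≤ F (Function.update ω e true) - F ω := fun ω =>
    sub_nonneg.2 (hF (le_update_true ω e))
  let L : (V → ℝ≥0) → ℝ := fun s => ∑ ω, (fkWeight (coupling b s) ω * F ω +
    T s * fkWeight (coupling b s) ω * (F (Function.update ω e true) - F ω))
  have hL0 : ∀ s, 0 ≤ L s := fun s => Finset.sum_nonneg fun ω _ => by
    have := fkWeight_nonneg (coupling_nonneg hb s) ω
    exact add_nonneg (mul_nonneg this (hF0 ω)) (mul_nonneg (mul_nonneg (hT0 s) this) (hle ω))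
  have iLω : ∀ ω ∈ Finset.univ, Integrable (fun s => fkWeight (coupling b s) ω * F ω +
      T s * fkWeight (coupling b s) ω * (F (Function.update ω e true) - F ω))
      (fieldMeasure V g a) := fun ω _ =>
    ((integrable_fkWeight hg a hb ω).mul_const _).add ((iT ω).mul_const _)
  have iL : Integrable L (fieldMeasure V g a) := integrable_finsetSum _ iLω
  have hLH : ∀ s, L s ≤ fkZ (coupling b s) * H s := fun s => by
    have h1 := fk_sprinkle (coupling_nonneg hb s) (mul_nonneg hc (pairProd_nonneg s e)) e hF hF0
    rw [← coupling_update, ← hb'_def] at h1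
    rw [mul_div_assoc', le_div_iff₀ (hZ hb' s)]
    refine le_trans (le_of_eq ?_) h1
    congr 1
    refine Finset.sum_congr rfl fun ω _ => ?_
    ring
  -- The order of averaging is exchanged here: for each fixed `ω` the field is integrated out, and
  -- `hε` replaces the random probability by `ε`.
  have hLint : ∑ ω, totalMass g a b ω * (F ω + ε * (F (Function.update ω e true) - F ω)) ≤
      ∫ s, L s ∂fieldMeasure V g a := by
    rw [integral_finsetSum _ iLω]
    refine Finset.sum_le_sum fun ω _ => ?_
    rw [integral_add ((integrable_fkWeight hg a hb ω).mul_const _) ((iT ω).mul_const _),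
      integral_mul_const, integral_mul_const]
    have h1 := mul_le_mul_of_nonneg_right (hε ω) (hle ω)
    have h2 : totalMass g a b ω = ∫ s, fkWeight (coupling b s) ω ∂fieldMeasure V g a := rfl
    rw [← h2]
    linarith
  have hone : ∀ {b : G.edgeSet → ℝ}, 0 ≤ b →
      ∫⁻ s, ENNReal.ofReal (fkZ (coupling b s)) ∂fieldMeasure V g a =
        ENNReal.ofReal (∑ ω, totalMass g a b ω) := fun hb => by
    simpa [fkZ] using lintegral_sum_fkWeight hg a hb (F := fun _ => 1) fun _ => zero_le_one
  have hlow : ENNReal.ofReal (∫ s, L s ∂fieldMeasure V g a) ≤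
      ∫⁻ s, ENNReal.ofReal (fkZ (coupling b s) * H s) ∂fieldMeasure V g a := by
    rw [ofReal_integral_eq_lintegral_ofReal iL (Filter.Eventually.of_forall hL0)]
    exact lintegral_mono fun s => ENNReal.ofReal_le_ofReal (hLH s)
  change (∫⁻ s, _ ∂fieldMeasure V g a) * (∫⁻ s, _ ∂fieldMeasure V g a) ≤
    (∫⁻ s, _ ∂fieldMeasure V g a) * (∫⁻ s, _ ∂fieldMeasure V g a) at four
  rw [hone hb, hone hb', lintegral_sum_fkWeight hg a hb' hF0] at four
  have fin := (mul_le_mul' hlow le_rfl).trans four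
  rw [← ENNReal.ofReal_mul (integral_nonneg hL0),
    ← ENNReal.ofReal_mul (sum_totalMass_pos hg a hb).le,
    ENNReal.ofReal_le_ofReal_iff (mul_nonneg (sum_totalMass_pos hg a hb).le
      (Finset.sum_nonneg fun ω _ => mul_nonneg (totalMass_nonneg g a hb' ω) (hF0 ω)))] at fin
  exact (mul_le_mul_of_nonneg_right hLint (sum_totalMass_pos hg a hb').le).trans fin

/-- The Bernoulli weight of parameter `ε` on `S` and `0` off `S`. -/
def bernWeight (ε : ℝ) (S : Finset G.edgeSet) (γ : Config G) : ℝ :=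
  ∏ e, if e ∈ S then (if γ e = true then ε else 1 - ε) else (if γ e = true then 0 else 1)

/-- The expectation of `F (ω ∪ γ)` for Bernoulli sprinkling `γ` of the edges in `S`. -/
def sprinkle (ε : ℝ) (S : Finset G.edgeSet) (F : Config G → ℝ) (ω : Config G) : ℝ :=
  ∑ γ, bernWeight ε S γ * F (ω ⊔ γ)

lemma bernWeight_nonneg {ε : ℝ} (h0 : 0 ≤ ε) (h1 : ε ≤ 1) (S : Finset G.edgeSet) (γ : Config G) :
    0 ≤ bernWeight ε S γ :=
  Finset.prod_nonneg fun e _ => by split_ifs <;> linarith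

lemma sprinkle_mono {ε : ℝ} (h0 : 0 ≤ ε) (h1 : ε ≤ 1) (S : Finset G.edgeSet)
    {F : Config G → ℝ} (hF : Monotone F) : Monotone (sprinkle ε S F) := fun _ _ h =>
  Finset.sum_le_sum fun γ _ => mul_le_mul_of_nonneg_left (hF (sup_le_sup_right h γ))
    (bernWeight_nonneg h0 h1 S γ)

lemma sprinkle_nonneg {ε : ℝ} (h0 : 0 ≤ ε) (h1 : ε ≤ 1) (S : Finset G.edgeSet)
    {F : Config G → ℝ} (hF : 0 ≤ F) : 0 ≤ sprinkle ε S F := fun _ =>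
  Finset.sum_nonneg fun γ _ => mul_nonneg (bernWeight_nonneg h0 h1 S γ) (hF _)

lemma sprinkle_empty (ε : ℝ) (F : Config G → ℝ) : sprinkle ε ∅ F = F := by
  funext ω
  rw [sprinkle, Finset.sum_eq_single ⊥]
  · simp [bernWeight]
  · intro γ _ hγ
    obtain ⟨e, he⟩ := Function.ne_iff.1 hγ
    have : γ e = true := by simpa using he
    rw [bernWeight, Finset.prod_eq_zero (Finset.mem_univ e) (by simp [this]), zero_mul]
  · simp

lemma bernWeight_update (ε : ℝ) (S : Finset G.edgeSet) (e : G.edgeSet) (γ : Config G) (o : Bool) :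
    bernWeight ε S (Function.update γ e o) =
      (if e ∈ S then (if o = true then ε else 1 - ε) else (if o = true then 0 else 1)) *
      ∏ i ∈ Finset.univ.erase e,
        if i ∈ S then (if γ i = true then ε else 1 - ε) else (if γ i = true then 0 else 1) := by
  rw [bernWeight, ← Finset.mul_prod_erase _ _ (Finset.mem_univ e), Function.update_self]
  congr 1
  refine Finset.prod_congr rfl fun i hi => ?_
  rw [Function.update_of_ne (Finset.ne_of_mem_erase hi)]

lemma sprinkle_insert (ε : ℝ) {S : Finset G.edgeSet} {e : G.edgeSet} (he : e ∉ S)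
    (F : Config G → ℝ) : sprinkle ε (insert e S) F = fun ω =>
      sprinkle ε S F ω + ε * (sprinkle ε S F (Function.update ω e true) - sprinkle ε S F ω) := by
  funext ω
  have h1 : sprinkle ε S F ω + ε * (sprinkle ε S F (Function.update ω e true) -
      sprinkle ε S F ω) = ∑ γ, bernWeight ε S γ *
        ((1 - ε) * F (ω ⊔ γ) + ε * F (Function.update ω e true ⊔ γ)) := by
    simp only [sprinkle, mul_add, Finset.sum_add_distrib, mul_left_comm (bernWeight _ _ _),
      ← Finset.mul_sum]
    ring
  rw [h1, sprinkle]
  apply mul_left_cancel₀ (two_ne_zero (α := ℝ))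
  rw [two_mul_sum_config e, two_mul_sum_config e]
  refine Finset.sum_congr rfl fun γ _ => ?_
  have hsup : Function.update ω e true ⊔ Function.update γ e false =
      ω ⊔ Function.update γ e true := by
    funext i
    by_cases hi : i = e
    · subst hi; simp
    · simp [Function.update_of_ne hi]
  have hR : ∏ i ∈ Finset.univ.erase e, (if i ∈ insert e S then (if γ i = true then ε else 1 - ε)
      else (if γ i = true then 0 else 1)) = ∏ i ∈ Finset.univ.erase e,
        if i ∈ S then (if γ i = true then ε else 1 - ε) else (if γ i = true then 0 else 1) :=
    Finset.prod_congr rfl fun i hi => by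
      simp only [Finset.mem_insert, Finset.ne_of_mem_erase hi, false_or]
  rw [bernWeight_update, bernWeight_update, bernWeight_update, bernWeight_update, hR, hsup]
  simp only [Finset.mem_insert_self, he, if_true, if_false, Bool.false_eq_true]
  ring

/-- Domination of the sprinkled expectation at the smaller coupling. -/
lemma rcExp_sprinkle_univ_le {g : ℝ} (hg : 0 < g) (a : ℝ) {β' β ε : ℝ} (hβ' : 0 ≤ β')
    (hβ : β' ≤ β) (hε0 : 0 ≤ ε) (hε1 : ε ≤ 1)
    (hε : ∀ (b : G.edgeSet → ℝ), 0 ≤ b → (∀ e, b e ≤ β) → ∀ (ω : Config G) (e : G.edgeSet),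
      ε * totalMass g a b ω ≤ ∫ s, Real.tanh ((β - β') * pairProd s e) *
        fkWeight (coupling b s) ω ∂fieldMeasure V g a)
    {F : Config G → ℝ} (hF : Monotone F) (hF0 : 0 ≤ F) :
    rcExp g a (fun _ => β') (sprinkle ε Finset.univ F) ≤ rcExp g a (fun _ => β) F := by
  -- Interpolation: edges in `S` have the low coupling and are sprinkled, the others keep `β`. The
  -- intermediate couplings are not constant, hence the quantifier over `b` in `hε`.
  suffices H : ∀ S : Finset G.edgeSet, rcExp g a (S.piecewise (fun _ => β') fun _ => β)
      (sprinkle ε S F) ≤ rcExp g a (fun _ => β) F by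
    simpa using H Finset.univ
  intro S
  induction S using Finset.induction_on with
  | empty => simp [sprinkle_empty]
  | insert e S he ih =>
    refine le_trans ?_ ih
    rw [sprinkle_insert ε he]
    set b := (insert e S).piecewise (fun _ => β') fun _ : G.edgeSet => β
    have hb : 0 ≤ b := Finset.le_piecewise_of_le_of_le _ (fun _ => hβ') (fun _ => hβ'.trans hβ)
    have hbβ : b ≤ fun _ => β := Finset.piecewise_le_of_le_of_le _ (fun _ => hβ) le_rfl
    have hbe : S.piecewise (fun _ => β') (fun _ : G.edgeSet => β) =
        Function.update b e (b e + (β - β')) := by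
      funext i
      by_cases hi : i = e
      · subst hi; simp [b, he]
      · simp [b, Finset.piecewise, hi]
    rw [hbe]
    exact rcExp_sprinkle_le hg a hb e (sub_nonneg.2 hβ) (fun ω => hε b hb hbβ ω e)
      (sprinkle_mono hε0 hε1 S hF) (sprinkle_nonneg hε0 hε1 S hF0)

end Domination

/-! ### Identification with the measures of the statement. -/

section Measures

variable {V : Type} [Fintype V] [DecidableEq V] {G : SimpleGraph V} [DecidableRel G.Adj]

/-- With `J = β s_x s_y` one has `√(1 - p) = exp (-J)` and `p / (1 - p) = exp (2 J) - 1`, so an open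
edge has weight `2 sinh J`. -/
lemma rcWeight_eq (β : ℝ) (ω : Config G) (s : V → ℝ≥0) :
    rcWeight β ω s = fkWeight (coupling (fun _ => β) s) ω := by
  rw [rcWeight, fkWeight]
  congr 1
  refine Finset.prod_congr rfl fun e _ => ?_
  have h : edgeProb β s e = 1 - Real.exp (-2 * (β * pairProd s e)) := by
    rw [edgeProb, pairProd, mul_assoc]
  have hs : Real.sqrt (Real.exp (-2 * (β * pairProd s e))) = Real.exp (-(β * pairProd s e)) := by
    rw [Real.sqrt_eq_iff_mul_self_eq (Real.exp_pos _).le (Real.exp_pos _).le, ← Real.exp_add]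
    ring_nf
  rw [h, sub_sub_cancel, hs, coupling, edgeFactor]
  generalize β * pairProd s e = J
  by_cases ho : ω e = true
  · simp only [ho, if_true, pow_one]
    have e2 : Real.exp (-2 * J) = Real.exp (-J) * Real.exp (-J) := by
      rw [← Real.exp_add]; ring_nf
    have e3 : Real.exp J * Real.exp (-J) = 1 := by rw [← Real.exp_add]; simp
    have p := Real.exp_pos (-J)
    rw [e2, Real.sinh_eq, mul_div_assoc', div_eq_iff (by positivity)]
    linear_combination (-Real.exp (-J)) * e3
  · simp [ho]

lemma freeRCUnnormalized_fiber {g : ℝ} (hg : 0 < g) (a : ℝ) {β : ℝ} (hβ : 0 ≤ β)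
    (ω : Config G) : (freeRCUnnormalized G g a β).map Prod.fst {ω} =
      ENNReal.ofReal (totalMass g a (fun _ : G.edgeSet => β) ω) := by
  have := isProbabilityMeasure_absSiteMeasure hg a
  have hb : (0 : G.edgeSet → ℝ) ≤ fun _ => β := fun _ => hβ
  have hmeas : Measurable fun x : Config G × (V → ℝ≥0) =>
      ENNReal.ofReal (rcWeight β x.1 x.2) := by
    refine measurable_from_prod_countable_right fun η => ?_
    simp only [rcWeight_eq]
    exact (measurable_fkWeight _ η).ennreal_ofReal
  have hset : Prod.fst ⁻¹' {ω} = ({ω} : Set (Config G)) ×ˢ (Set.univ : Set (V → ℝ≥0)) := by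
    ext x; simp
  rw [Measure.map_apply measurable_fst (MeasurableSet.singleton ω), freeRCUnnormalized,
    withDensity_apply _ (measurable_fst (MeasurableSet.singleton ω)), hset,
    ← Measure.prod_restrict, Measure.restrict_univ, Measure.restrict_singleton,
    Measure.count_singleton, one_smul, Measure.dirac_prod,
    lintegral_map hmeas measurable_prodMk_left, totalMass, ofReal_integral_eq_lintegral_ofReal
      (integrable_fkWeight hg a hb ω)
      (Filter.Eventually.of_forall fun s => fkWeight_nonneg (coupling_nonneg hb s) ω)]
  simp only [rcWeight_eq]
  rfl

lemma freeRCUnnormalized_univ {g : ℝ} (hg : 0 < g) (a : ℝ) {β : ℝ} (hβ : 0 ≤ β) :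
    freeRCUnnormalized G g a β Set.univ =
      ENNReal.ofReal (∑ ω, totalMass g a (fun _ : G.edgeSet => β) ω) := by
  have h : freeRCUnnormalized G g a β Set.univ =
      (freeRCUnnormalized G g a β).map Prod.fst Set.univ := by
    rw [Measure.map_apply measurable_fst MeasurableSet.univ, Set.preimage_univ]
  rw [h, ← Finset.coe_univ, ← sum_measure_singleton,
    ENNReal.ofReal_sum_of_nonneg fun ω _ => totalMass_nonneg g a (fun _ => hβ) ω]
  exact Finset.sum_congr rfl fun ω _ => freeRCUnnormalized_fiber hg a hβ ω

lemma freeRCEdge_singleton {g : ℝ} (hg : 0 < g) (a : ℝ) {β : ℝ} (hβ : 0 ≤ β) (ω : Config G) :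
    freeRCEdge G g a β {ω} = ENNReal.ofReal (totalMass g a (fun _ : G.edgeSet => β) ω /
      ∑ η, totalMass g a (fun _ : G.edgeSet => β) η) := by
  rw [freeRCEdge, freeRC, Measure.map_smul, Measure.smul_apply,
    freeRCUnnormalized_fiber hg a hβ, freeRCUnnormalized_univ hg a hβ, smul_eq_mul,
    ENNReal.ofReal_div_of_pos (sum_totalMass_pos hg a fun _ => hβ), ENNReal.div_eq_inv_mul]

lemma isProbabilityMeasure_freeRCEdge {g : ℝ} (hg : 0 < g) (a : ℝ) {β : ℝ} (hβ : 0 ≤ β) :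
    IsProbabilityMeasure (freeRCEdge G g a β) := by
  have hb : (0 : G.edgeSet → ℝ) ≤ fun _ => β := fun _ => hβ
  constructor
  rw [← Finset.coe_univ, ← sum_measure_singleton]
  simp only [freeRCEdge_singleton hg a hβ]
  rw [← ENNReal.ofReal_sum_of_nonneg fun ω _ => div_nonneg (totalMass_nonneg g a hb ω)
    (sum_totalMass_pos hg a hb).le, ← Finset.sum_div, div_self (sum_totalMass_pos hg a hb).ne',
    ENNReal.ofReal_one]

lemma integral_freeRCEdge {g : ℝ} (hg : 0 < g) (a : ℝ) {β : ℝ} (hβ : 0 ≤ β)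
    (F : Config G → ℝ) : ∫ ω, F ω ∂freeRCEdge G g a β = rcExp g a (fun _ => β) F := by
  have := isProbabilityMeasure_freeRCEdge (G := G) hg a hβ
  have hb : (0 : G.edgeSet → ℝ) ≤ fun _ => β := fun _ => hβ
  rw [integral_fintype .of_finite, rcExp, Finset.sum_div]
  refine Finset.sum_congr rfl fun ω _ => ?_
  rw [measureReal_def, freeRCEdge_singleton hg a hβ, ENNReal.toReal_ofReal (div_nonneg
    (totalMass_nonneg g a hb ω) (sum_totalMass_pos hg a hb).le), smul_eq_mul, div_mul_eq_mul_div]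

lemma bernoulliPerc_singleton (ε : I) (γ : Config G) :
    (bernoulliPerc G ε).real {γ} = bernWeight (ε : ℝ) Finset.univ γ := by
  rw [bernoulliPerc, measureReal_def, Measure.pi_singleton, ENNReal.toReal_prod, bernWeight]
  refine Finset.prod_congr rfl fun e _ => ?_
  rw [← measureReal_def, ProbabilityTheory.bernoulliMeasure_real_apply ε
    (MeasurableSet.singleton _)]
  cases h : γ e <;> simp

instance (ε : I) : IsProbabilityMeasure (bernoulliPerc G ε) := by
  unfold bernoulliPerc
  infer_instance

lemma measurable_unionConfig : Measurable (unionConfig G) := measurable_of_countable _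

lemma isProbabilityMeasure_sprinkledRCEdge {g : ℝ} (hg : 0 < g) (a : ℝ) {β : ℝ} (hβ : 0 ≤ β)
    (ε : I) : IsProbabilityMeasure (sprinkledRCEdge G g a β ε) := by
  have := isProbabilityMeasure_freeRCEdge (G := G) hg a hβ
  exact Measure.isProbabilityMeasure_map measurable_unionConfig.aemeasurable

lemma integral_sprinkledRCEdge {g : ℝ} (hg : 0 < g) (a : ℝ) {β : ℝ} (hβ : 0 ≤ β) (ε : I)
    (F : Config G → ℝ) : ∫ ω, F ω ∂sprinkledRCEdge G g a β ε =
      rcExp g a (fun _ => β) (sprinkle (ε : ℝ) Finset.univ F) := by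
  have := isProbabilityMeasure_freeRCEdge (G := G) hg a hβ
  rw [sprinkledRCEdge, integral_map measurable_unionConfig.aemeasurable
    (measurable_of_countable F).aestronglyMeasurable, integral_prod _ .of_finite,
    ← integral_freeRCEdge hg a hβ]
  congr 1
  funext ω
  rw [integral_fintype .of_finite, sprinkle]
  refine Finset.sum_congr rfl fun γ _ => ?_
  rw [bernoulliPerc_singleton]
  rfl

/-- Subtracting the minimum `F ⊥` makes `F` nonnegative, as the four functions theorem requires. -/
lemma stochDominates_of_nonneg {Ω : Type} [MeasurableSpace Ω] [Finite Ω]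
    [MeasurableSingletonClass Ω] [Preorder Ω] [OrderBot Ω] {μ ν : Measure Ω}
    [IsProbabilityMeasure μ] [IsProbabilityMeasure ν]
    (h : ∀ F : Ω → ℝ, Monotone F → 0 ≤ F → ∫ ω, F ω ∂ν ≤ ∫ ω, F ω ∂μ) : StochDominates μ ν := by
  intro F hF _ _
  have h1 := h (fun ω => F ω - F ⊥) (fun _ _ hab => sub_le_sub_right (hF hab) _)
    fun ω => sub_nonneg.2 (hF bot_le)
  rw [integral_sub .of_finite .of_finite, integral_sub .of_finite .of_finite] at h1
  simpa using h1

end Measures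

/-! ### Degree bound on the lattice and conclusion. -/

lemma card_star_boxGraph_le {d : ℕ} (Λ : Finset (Fin d → ℤ)) (x : Λ) :
    (star (boxGraph Λ) x).card ≤ 3 ^ d := by
  have hcard : (Fintype.piFinset fun _ : Fin d => Finset.Icc (-1 : ℤ) 1).card = 3 ^ d := by
    simp
  rw [← hcard]
  refine Finset.card_le_card_of_injOn (fun e => (otherEnd x e).1 - x.1) ?_ ?_
  · intro e he
    have hadj : (boxGraph Λ).Adj x (otherEnd x e) := by
      have := e.2
      rwa [(star_spec he).1, SimpleGraph.mem_edgeSet] at this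
    have hsum : ∑ i, |x.1 i - (otherEnd x e).1 i| = 1 := hadj
    refine Fintype.mem_piFinset.2 fun i => ?_
    have hi : |x.1 i - (otherEnd x e).1 i| ≤ 1 := by
      rw [← hsum]
      exact Finset.single_le_sum
        (f := fun i => |x.1 i - (otherEnd x e).1 i|)
        (fun _ _ => abs_nonneg _) (Finset.mem_univ i)
    rw [abs_sub_comm] at hi
    exact Finset.mem_Icc.2 (abs_le.1 hi)
  · intro e he e' he' h
    have : otherEnd x e = otherEnd x e' := Subtype.ext (sub_left_injective h)
    exact Subtype.ext (by rw [(star_spec he).1, (star_spec he').1, this])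

end Phi4
end

theorem mainTheorem8 (d : ℕ) (g a : ℝ) (hg : 0 < g) (β' β : ℝ) (hβ' : 0 < β') (hβ : β' < β) :
    ∃ ε : unitInterval, 0 < ε ∧ ∀ Λ : Finset (Fin d → ℤ),
      Phi4.StochDominates
        (Phi4.freeRCEdge (Phi4.boxGraph Λ) g a β)
        (Phi4.sprinkledRCEdge (Phi4.boxGraph Λ) g a β' ε) := by
  have hβ0 : 0 ≤ β := (hβ'.trans hβ).le
  -- The crude degree bound `3 ^ d`, counting displacements in `{-1, 0, 1}^d`, is positive even for
  -- `d = 0`, where `2 * d` is not.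
  obtain ⟨ε, hε0, hε1, hε⟩ := Phi4.exists_le_integral_tanh hg a hβ0 (Δ := 3 ^ d) (by positivity)
    (sub_pos.2 hβ)
  refine ⟨⟨ε, hε0.le, hε1⟩, hε0, fun Λ => ?_⟩
  have := Phi4.isProbabilityMeasure_freeRCEdge (G := Phi4.boxGraph Λ) hg a hβ0
  have := Phi4.isProbabilityMeasure_sprinkledRCEdge (G := Phi4.boxGraph Λ) hg a hβ'.le
    ⟨ε, hε0.le, hε1⟩
  refine Phi4.stochDominates_of_nonneg fun F hF hF0 => ?_
  rw [Phi4.integral_sprinkledRCEdge hg a hβ'.le, Phi4.integral_freeRCEdge hg a hβ0]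
  exact Phi4.rcExp_sprinkle_univ_le hg a hβ'.le hβ.le hε0.le hε1
    (fun b hb hbβ ω e => hε Λ (Phi4.boxGraph Λ) b ω e (Phi4.card_star_boxGraph_le Λ) hb hbβ) hF hF0
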